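/- Let $G=(V,E)$ be a locally finite, connected (simple, undirected) graph that is transitive (for all $x,y\in V$ some automorphism of $G$ takes $x$ to $y$) and unimodular (the group $\mathrm{Aut}(G)$, with the topology of pointwise convergence, is unimodular, i.e. it has a left Haar measure that is also right invariant). For a graph $H$ and $p\in[0,1]$, let $H[p]$ be Bernoulli($p$) bond percolation on $H$, realized as the set of edges $e$ of $H$ with $U(e)<p$, where the labels $U(e)$ are i.i.d. uniform on $[0,1]$. An infinite cluster is an infinite connected component. Put $$p_c(H)=\inf\{p\in[0,1] : H[p]\text{ has an infinite cluster a.s.}\},\qquad p_u(H)=\inf\{p\in[0,1] : H[p]\text{ has a unique infinite cluster a.s.}\},$$ with infima taken in $[0,1]$, so that $\inf\emptyset=1$ (this matters only for finite $G$). Let $U=(U(e))_{e\in E}$ be i.i.d. uniform $[0,1]$ labels on the edges of $G$, and let the free minimal spanning forest $\mathfrak F_f=\mathfrak F_f(U)$ be the spanning subgraph of $G$ consisting of those edges $e\in E$ such that every path in $G$ connecting the endpoints of $e$ contains an edge $e'$ with $U(e')\ge U(e)$. Here $p_c(\mathfrak F_f)$ is the critical probability of the random graph $\mathfrak F_f$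 itself: it is computed, for given $U$, with percolation on $\mathfrak F_f$ whose labels are independent of $U$. Then $$p_c(G)<p_u(G)\quad\Longleftrightarrow\quad p_c(\mathfrak F_f)<1\ \text{ almost surely.}$$ -/

import Mathlib

open MeasureTheory

noncomputable section

namespace MinimalForest

variable {V : Type*}

/-- The topology of pointwise convergence on the automorphism group of a graph
(the vertex set being discrete). -/
abbrev autTopology (G : SimpleGraph V) : TopologicalSpace (G ≃g G) :=
  TopologicalSpace.induced (fun φ => (φ : V → V))
    (@Pi.topologicalSpace V (fun _ => V) (fun _ => ⊥))

/-- The automorphism group is unimodular: with the topology of pointwise convergence and its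
Borel σ-algebra, it carries a (left) Haar measure that is also right invariant. -/
def IsUnimodular (G : SimpleGraph V) : Prop :=
  letI : TopologicalSpace (G ≃g G) := autTopology G
  letI : MeasurableSpace (G ≃g G) := borel (G ≃g G)
  ∃ μ : Measure (G ≃g G), μ.IsHaarMeasure ∧ μ.IsMulRightInvariant

/-- Every vertex can be taken to every other one by an automorphism. -/
def IsTransitive (G : SimpleGraph V) : Prop :=
  ∀ x y : V, ∃ φ : G ≃g G, φ x = y

/-- The law of i.i.d. uniform `[0, 1]` labels on the edges of `H`. -/
def labelLaw (H : SimpleGraph V) : Measure (H.edgeSet → unitInterval) :=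
  Measure.infinitePi (fun _ => (volume : Measure unitInterval))

/-- Under `labelLaw H`, this is Bernoulli(`p`) bond percolation `H[p]` in the standard coupling:
the spanning subgraph of `H` whose edges are those with label less than `p`. -/
def percolation (H : SimpleGraph V) (U : H.edgeSet → unitInterval) (p : unitInterval) :
    SimpleGraph V where
  Adj x y := ∃ h : s(x, y) ∈ H.edgeSet, U ⟨s(x, y), h⟩ < p
  symm := ⟨by
    rintro x y ⟨h, hU⟩
    rw [← Sym2.eq_swap]
    exact ⟨h, hU⟩⟩
  loopless := ⟨by
    rintro x ⟨h, -⟩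
    exact H.loopless.irrefl x h⟩

/-- The critical probability of a (not necessarily connected) graph: the infimum in `[0, 1]` of
those `p` such that `H[p]` has an infinite cluster almost surely. -/
def criticalProb (H : SimpleGraph V) : unitInterval :=
  sInf {p | ∀ᵐ U ∂(labelLaw H),
    ∃ C : (percolation H U p).ConnectedComponent, C.supp.Infinite}

/-- The uniqueness threshold: the infimum in `[0, 1]` of those `p` such that `H[p]` has a unique
infinite cluster almost surely. -/
def uniquenessProb (H : SimpleGraph V) : unitInterval :=
  sInf {p | ∀ᵐ U ∂(labelLaw H),
    ∃! C : (percolation H U p).ConnectedComponent, C.supp.Infinite}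

/-- The free minimal spanning forest of the labeling `U`: the edges `e` of `G` such that every path
of `G` joining the endpoints of `e` contains an edge `e'` with `U e' ≥ U e`. -/
def freeForest (G : SimpleGraph V) (U : G.edgeSet → unitInterval) : SimpleGraph V where
  Adj x y := ∃ h : s(x, y) ∈ G.edgeSet, ∀ w : G.Walk x y,
    ∃ e' : G.edgeSet, (e' : Sym2 V) ∈ w.edges ∧ U e' ≥ U ⟨s(x, y), h⟩
  symm := ⟨by
    rintro x y ⟨h, hU⟩
    rw [← Sym2.eq_swap]
    refine ⟨h, fun w => ?_⟩
    obtain ⟨e', he', hle⟩ := hU w.reverse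
    exact ⟨e', by simpa using he', hle⟩⟩
  loopless := ⟨by
    rintro x ⟨h, -⟩
    exact G.loopless.irrefl x h⟩

end MinimalForest

end

/-!
The labels `U` are extended to labels of all unordered pairs of vertices, next to a second,
independent family used to percolate on the free forest. Unimodularity enters only through the
mass-transport principle (`mass_transport`): for a diagonally invariant `f`, the total mass
`∑ y, f o y` sent by a vertex is the total mass `∑ y, f y o` it receives. Besides the free forest,
there is the wired forest, consisting of its edges `e` for which the clusters of labels less than
`U e` at the two endpoints are not both infinite.

Three facts about expected degrees carry the proof.

* `two_le_expDegree`: an invariant random graph all of whose components are infinite has expected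
  degree at least two. The two half-edges of an edge both go to one endpoint if only the
  other endpoint has an infinite component after removal of the edge, and one goes to each endpoint
  otherwise; every vertex then gets at least two.
* `expDegree_le_two`: an invariant random graph has expected degree at most two if each of its edges
  `e`, added to the edges of smaller label, merges two different clusters, at least one of which is
  finite. Indeed each edge then kills the leader of a finite cluster, and nobody is killed twice.
* If the expected degree is two, the components have at most two ends (`ae_tsum_outWeight_eq_two`),
  and if they are trees, percolation on them with parameter less than one leaves only finite
  clusters (`ae_not_infAt_below`).

Suppose `p_c < p_u`. For levels between them, there are edges joining two infinite clusters, by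
finite energy, so the free forest differs from the wired one (`exists_infSeparated`). The wired
forest has infinite components, hence expected degree at least two, so the free forest has expected
degree more than two, and so does its percolation of some parameter `r < 1`. If this had only finite
clusters, its expected degree would be at most two. Ergodicity makes the infinite cluster almost
sure, and `p_c` of the free forest is at most `r`.

Suppose `p_c = p_u`. Uniqueness of the infinite cluster is inherited by higher levels
(`ae_reachable_of_lt`): otherwise, one could open a single edge to attach an infinite set free of
infinite clusters of the lower level to the rest of a cluster, and if all vertices of this set send
mass to that edge, it receives infinite mass. Hence the free forest is the wired forest almost
surely (`unif_infSeparated_eq_zero`). Its expected degree is two, so its critical probability is one.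
-/

namespace MinimalForest

/-! ### Independent uniform labels -/

section Labels

variable {α β : Type*}

/-- The law of i.i.d. uniform `[0, 1]` labels on an arbitrary index type. -/
noncomputable abbrev unif (α : Type*) : Measure (α → unitInterval) :=
  Measure.infinitePi fun _ => (volume : Measure unitInterval)

theorem measurePreserving_unif_comp {j : α → β} (hj : Function.Injective j) :
    MeasurePreserving (fun ω : β → unitInterval => fun a => ω (j a)) (unif β) (unif α) :=
  ⟨by fun_prop, Measure.map_infinitePi_infinitePi_of_inj
    (P := fun _ : β => (volume : Measure unitInterval)) hj⟩

theorem measurePreserving_unif_sum :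
    MeasurePreserving (fun ω : α ⊕ β → unitInterval =>
      ((fun a => ω (.inl a)), (fun b => ω (.inr b)))) (unif (α ⊕ β))
      ((unif α).prod (unif β)) := by
  have hm : Measurable fun p : (α → unitInterval) × (β → unitInterval) =>
      (Sum.elim p.1 p.2 : α ⊕ β → unitInterval) := by
    refine measurable_pi_lambda _ fun i => ?_
    cases i <;> simp only [Sum.elim_inl, Sum.elim_inr] <;> fun_prop
  have key : ((unif α).prod (unif β)).map (fun p => (Sum.elim p.1 p.2 : α ⊕ β → unitInterval))
      = unif (α ⊕ β) := by
    refine Measure.eq_infinitePi _ fun s t ht => ?_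
    rw [Measure.map_apply hm (MeasurableSet.pi s.countable_toSet fun i _ => ht i)]
    have : (fun p : (α → unitInterval) × (β → unitInterval) =>
        (Sum.elim p.1 p.2 : α ⊕ β → unitInterval)) ⁻¹' (Set.pi s t)
        = (Set.pi (s.toLeft : Set α) fun a => t (.inl a)) ×ˢ
          (Set.pi (s.toRight : Set β) fun b => t (.inr b)) := by
      ext p
      simp [Set.mem_pi]
    rw [this, Measure.prod_prod, Measure.infinitePi_pi _ fun i _ => ht _,
      Measure.infinitePi_pi _ fun i _ => ht _, ← Finset.toLeft_disjSum_toRight (u := s)]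
    simp [Finset.prod_disjSum]
  refine ⟨by fun_prop, ?_⟩
  rw [← key, Measure.map_map (by fun_prop) hm]
  exact Measure.map_id

/-- Resampling one label does not change the law. -/
theorem measurePreserving_update [DecidableEq α] (i : α) :
    MeasurePreserving (fun p : (α → unitInterval) × unitInterval => Function.update p.1 i p.2)
      ((unif α).prod volume) (unif α) := by
  have hm : Measurable fun p : (α → unitInterval) × unitInterval =>
      Function.update p.1 i p.2 := by
    refine measurable_pi_lambda _ fun j => ?_
    by_cases h : j = i
    · subst h; simpa using measurable_snd
    · simp only [Function.update_of_ne h]; fun_prop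
  refine ⟨hm, Measure.eq_infinitePi _ fun s t ht => ?_⟩
  rw [Measure.map_apply hm (MeasurableSet.pi s.countable_toSet fun i _ => ht i)]
  have : (fun p : (α → unitInterval) × unitInterval => Function.update p.1 i p.2) ⁻¹' (Set.pi s t)
      = (Set.pi ((s.erase i : Finset α) : Set α) t) ×ˢ (if i ∈ s then t i else Set.univ) := by
    ext p
    simp only [Set.mem_preimage, Set.mem_pi, Set.mem_prod, Finset.mem_coe, Finset.mem_erase]
    constructor
    · intro h
      refine ⟨fun j hj => by simpa [hj.1] using h j hj.2, ?_⟩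
      split_ifs with hi
      · simpa using h i hi
      · trivial
    · rintro ⟨h1, h2⟩ j hj
      by_cases h : j = i
      · subst h; simpa [hj] using h2
      · simpa [h] using h1 j ⟨h, hj⟩
  rw [this, Measure.prod_prod, Measure.infinitePi_pi _ fun i _ => ht _]
  split_ifs with hi
  · rw [Finset.prod_erase_mul _ _ hi]
  · simp [Finset.erase_eq_of_notMem hi]

/-- Insertion tolerance: if resampling the label at `i` within a non-null set `T` leads from the
non-null event `A` to the event `B`, then `B` is not null. -/
theorem unif_ne_zero_of_update [DecidableEq α] (i : α) {A B : Set (α → unitInterval)}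
    {T : Set unitInterval} (hT : volume T ≠ 0) (hA : unif α A ≠ 0)
    (h : ∀ ω ∈ A, ∀ t ∈ T, Function.update ω i t ∈ B) : unif α B ≠ 0 := by
  intro hB
  have h1 := Measure.le_map_apply (μ := (unif α).prod volume)
    (measurePreserving_update i).measurable.aemeasurable B
  rw [(measurePreserving_update i).map_eq, hB] at h1
  have h2 : A ×ˢ T ⊆
      (fun p : (α → unitInterval) × unitInterval => Function.update p.1 i p.2) ⁻¹' B :=
    fun p hp => h p.1 hp.1 p.2 hp.2
  have h3 := (measure_mono h2).trans h1
  rw [Measure.prod_prod] at h3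
  exact mul_ne_zero hA hT (le_antisymm h3 bot_le)

/-- An event is null if and only if it is null for almost every value of the label at `i`. -/
theorem unif_eq_zero_iff_update [DecidableEq α] (i : α) {B : Set (α → unitInterval)}
    (hB : MeasurableSet B) :
    unif α B = 0 ↔ ∀ᵐ t, unif α {ω | Function.update ω i t ∈ B} = 0 := by
  have hm := (measurePreserving_update i).measurable hB
  conv_lhs => rw [← (measurePreserving_update i).map_eq,
    Measure.map_apply (measurePreserving_update i).measurable hB, Measure.prod_apply_symm hm,
    lintegral_eq_zero_iff (measurable_measure_prodMk_right hm)]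
  rfl

/-- An event that does not depend on the label at `i` is independent of that label. -/
theorem unif_inter_label [DecidableEq α] (i : α) {A : Set (α → unitInterval)}
    (hA : MeasurableSet A) (h : ∀ ω t, Function.update ω i t ∈ A ↔ ω ∈ A)
    {T : Set unitInterval} (hT : MeasurableSet T) :
    unif α (A ∩ {ω | ω i ∈ T}) = unif α A * volume T := by
  have hm : MeasurableSet (A ∩ {ω | ω i ∈ T}) := hA.inter (measurable_pi_apply i hT)
  conv_lhs => rw [← (measurePreserving_update i).map_eq,
    Measure.map_apply (measurePreserving_update i).measurable hm]
  rw [← Measure.prod_prod]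
  congr 1
  ext p
  simp [h]

theorem ae_injective_unif [Countable α] :
    ∀ᵐ ω ∂(unif α), Function.Injective ω := by
  classical
  have h : ∀ p : α × α, p.1 ≠ p.2 → ∀ᵐ ω ∂(unif α), ω p.1 ≠ ω p.2 := by
    rintro ⟨i, j⟩ hij
    have hm : MeasurableSet {ω : α → unitInterval | ω i = ω j} :=
      measurableSet_eq_fun (by fun_prop) (by fun_prop)
    rw [ae_iff]
    simp only [ne_eq, not_not]
    have hij' : j ≠ i := fun h => hij h.symm
    rw [← (measurePreserving_update i).map_eq,
      Measure.map_apply (measurePreserving_update i).measurable hm,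
      Measure.prod_apply ((measurePreserving_update i).measurable hm)]
    have : ∀ ω : α → unitInterval, (volume : Measure unitInterval) (Prod.mk ω ⁻¹'
        ((fun p : (α → unitInterval) × unitInterval => Function.update p.1 i p.2) ⁻¹'
          {ω | ω i = ω j})) = 0 := by
      intro ω
      convert measure_singleton (μ := (volume : Measure unitInterval)) (ω j) using 2
      ext t
      simp [Function.update_of_ne hij']
    rw [lintegral_congr this, lintegral_zero]
  have h2 : ∀ᵐ ω ∂(unif α), ∀ p : α × α, p.1 ≠ p.2 → ω p.1 ≠ ω p.2 := by
    rw [ae_all_iff]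
    intro p
    by_cases hp : p.1 = p.2
    · simp [hp]
    · filter_upwards [h p hp] with ω hω _ using hω
  filter_upwards [h2] with ω hω i j hij
  by_contra hne
  exact hω (i, j) hne hij

open scoped symmDiff in
/-- Ergodicity of i.i.d. labels: an event invariant under permutations of the index set that move
every finite set off itself has probability zero or one. -/
theorem unif_zero_or_one {A : Set (α → unitInterval)} (hA : MeasurableSet A)
    (h : ∀ S : Finset α, ∃ e : α ≃ α, (∀ i ∈ S, e i ∉ S) ∧
      ∀ ω : α → unitInterval, (fun i => ω (e i)) ∈ A ↔ ω ∈ A) :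
    unif α A = 0 ∨ unif α A = 1 := by
  classical
  set μ := unif α with hμ
  suffices H : μ.real A = 0 ∨ μ.real A = 1 by
    simpa [Measure.real, ENNReal.toReal_eq_zero_iff, ENNReal.toReal_eq_one_iff] using H
  -- For a cylinder event `B` close to `A`, and `e` moving its finite index set off itself, `B` is
  -- independent of its image under `e`, and both are close to `A`: so `P(A)` is close to `P(A)²`.
  have key : ∀ ε : ℝ, 0 < ε → |μ.real A - μ.real A ^ 2| ≤ 4 * ε := by
    intro ε hε
    have hring : IsSetRing (measurableCylinders fun _ : α => unitInterval) :=
      ⟨empty_mem_measurableCylinders _, fun _ _ => union_mem_measurableCylinders,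
        fun _ _ => sdiff_mem_measurableCylinders⟩
    obtain ⟨B, hBC, hB⟩ := exists_measure_symmDiff_lt_of_generateFrom_isSetRing (μ := μ) hring
      ⟨{Set.univ}, by simp,
        by simpa using univ_mem_measurableCylinders (fun _ : α => unitInterval), by simp⟩
      generateFrom_measurableCylinders.symm hA (ENNReal.ofReal_pos.2 hε)
    have hBm : MeasurableSet B :=
      MeasurableSet.of_mem_measurableCylinders (α := fun _ : α => unitInterval) hBC
    obtain ⟨S, B0, hB0, hBeq⟩ := (mem_measurableCylinders (α := fun _ : α => unitInterval) B).1 hBC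
    obtain ⟨e, he, heA⟩ := h S
    have hmp : MeasurePreserving (fun ω : α → unitInterval => fun a => ω (e a)) μ μ :=
      measurePreserving_unif_comp e.injective
    set Φ : (α → unitInterval) → (α → unitInterval) := fun ω a => ω (e a)
    have hAe : Φ ⁻¹' A = A := by ext ω; exact heA ω
    have hB' : μ.real (B ∆ A) ≤ ε := by
      rw [Measure.real]
      exact ENNReal.toReal_le_of_le_ofReal hε.le hB.le
    have hBe : μ.real ((Φ ⁻¹' B) ∆ A) ≤ ε := by
      have : (Φ ⁻¹' B) ∆ A = Φ ⁻¹' (B ∆ A) := by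
        rw [Set.preimage_symmDiff, hAe]
      rw [this, Measure.real, hmp.measure_preimage (hBm.symmDiff hA).nullMeasurableSet]
      exact hB'
    have hind : μ.real (B ∩ Φ ⁻¹' B) = μ.real B ^ 2 := by
      have hI : ProbabilityTheory.iIndepFun (fun i (ω : α → unitInterval) => ω i) μ :=
        ProbabilityTheory.iIndepFun_infinitePi
          (P := fun _ : α => (volume : Measure unitInterval)) (X := fun _ x => x)
          (fun _ => measurable_id)
      have hdis : Disjoint S (S.map e.toEmbedding) := by
        rw [Finset.disjoint_left]
        intro i hi hi'
        obtain ⟨j, hj, rfl⟩ := Finset.mem_map.1 hi'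
        exact he j hj hi
      have h2 := hI.indepFun_finset S (S.map e.toEmbedding) hdis (fun i => by fun_prop)
      set T := S.map e.toEmbedding with hT
      let g : (T → unitInterval) → (S → unitInterval) :=
        fun f i => f ⟨e i, Finset.mem_map_of_mem _ i.2⟩
      have hg : Measurable g := by fun_prop
      have h3 := h2.measure_inter_preimage_eq_mul _ _ hB0 (hg hB0)
      have e1 : (fun (a : α → unitInterval) (i : S) => a i) ⁻¹' B0 = B := hBeq.symm
      have e2 : (fun (a : α → unitInterval) (i : T) => a i) ⁻¹'
          (g ⁻¹' B0) = Φ ⁻¹' B := by rw [hBeq]; rfl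
      rw [e1, e2, hmp.measure_preimage hBm.nullMeasurableSet] at h3
      rw [Measure.real, h3, ENNReal.toReal_mul, sq]; rfl
    have h1 : |μ.real B - μ.real A| ≤ ε :=
      (abs_measureReal_sub_le_measureReal_symmDiff' hBm.nullMeasurableSet hA.nullMeasurableSet
        (by simp) (by simp)).trans hB'
    have h2 : |μ.real (B ∩ Φ ⁻¹' B) - μ.real A| ≤ 2 * ε := by
      have hBem : MeasurableSet (Φ ⁻¹' B) := hmp.measurable hBm
      refine (abs_measureReal_sub_le_measureReal_symmDiff' (hBm.inter hBem).nullMeasurableSet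
        hA.nullMeasurableSet (by simp) (by simp)).trans ?_
      have hsub : (B ∩ Φ ⁻¹' B) ∆ A ⊆ (B ∆ A) ∪ ((Φ ⁻¹' B) ∆ A) := by
        intro ω
        simp only [Set.mem_symmDiff, Set.mem_inter_iff, Set.mem_union]
        tauto
      have := (measureReal_mono (μ := μ) hsub).trans (measureReal_union_le _ _)
      linarith
    rw [hind] at h2
    have hb1 : μ.real B ≤ 1 := measureReal_le_one
    have ha1 : μ.real A ≤ 1 := measureReal_le_one
    have hb0 : 0 ≤ μ.real B := measureReal_nonneg
    have ha0 : 0 ≤ μ.real A := measureReal_nonneg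
    rw [abs_le] at *
    constructor <;> nlinarith
  have h0 : |μ.real A - μ.real A ^ 2| = 0 := by
    refine le_antisymm (le_of_forall_pos_le_add fun ε hε => ?_) (abs_nonneg _)
    have := key (ε / 4) (by positivity)
    linarith
  rw [abs_eq_zero] at h0
  have : μ.real A * (1 - μ.real A) = 0 := by linarith
  rcases mul_eq_zero.1 this with h | h
  · exact Or.inl h
  · exact Or.inr (by linarith)

end Labels

/-! ### Automorphisms and the mass-transport principle -/

section Automorphisms

variable {V : Type*} {G : SimpleGraph V}

theorem finite_walk_endpoints [G.LocallyFinite] (n : ℕ) (x : V) :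
    {y | ∃ w : G.Walk x y, w.length = n}.Finite := by
  induction n generalizing x with
  | zero =>
    refine (Set.finite_singleton x).subset ?_
    rintro y ⟨w, hw⟩
    exact (SimpleGraph.Walk.eq_of_length_eq_zero hw).symm
  | succ n ih =>
    have hfin : (G.neighborSet x).Finite := Set.toFinite _
    refine (hfin.biUnion fun z _ => ih z).subset ?_
    rintro y ⟨w, hw⟩
    cases w with
    | nil => simp at hw
    | cons h w' =>
      simp only [SimpleGraph.Walk.length_cons, Nat.add_right_cancel_iff] at hw
      exact Set.mem_biUnion h ⟨w', hw⟩

theorem countable_of_connected [G.LocallyFinite] (hconn : G.Connected) : Countable V := by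
  obtain ⟨o⟩ := hconn.nonempty
  rw [← Set.countable_univ_iff]
  refine (Set.countable_iUnion fun n => (finite_walk_endpoints (G := G) n o).countable).mono ?_
  intro y _
  obtain ⟨w⟩ := hconn.preconnected o y
  exact Set.mem_iUnion.2 ⟨w.length, w, rfl⟩

/-- In an infinite transitive graph, some automorphism moves a given finite set off itself. -/
theorem exists_aut_disjoint [G.LocallyFinite] [Infinite V] (hconn : G.Connected)
    (htrans : IsTransitive G) (T : Finset V) : ∃ φ : G ≃g G, ∀ x ∈ T, φ x ∉ T := by
  obtain ⟨o⟩ := hconn.nonempty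
  have hw : ∀ x, ∃ n, ∃ w : G.Walk x o, w.length = n := fun x => by
    obtain ⟨w⟩ := hconn.preconnected x o
    exact ⟨_, w, rfl⟩
  choose n hn using hw
  -- If `φ` takes a point of `T` to a point of `T`, then `φ o` is in this finite set.
  have hfin : (⋃ x ∈ T, ⋃ x' ∈ T, {y | ∃ w : G.Walk x' y, w.length = n x}).Finite :=
    T.finite_toSet.biUnion fun x _ => T.finite_toSet.biUnion fun x' _ =>
      finite_walk_endpoints _ _
  obtain ⟨y, hy⟩ := hfin.exists_notMem
  obtain ⟨φ, rfl⟩ := htrans o y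
  refine ⟨φ, fun x hx hφ => hy ?_⟩
  simp only [Set.mem_iUnion]
  obtain ⟨w, hw⟩ := hn x
  exact ⟨x, hx, φ x, hφ, w.map φ.toHom, by simpa using hw⟩

section Stabilizer

attribute [local instance] autTopology

theorem isOpen_apply_eq (x y : V) : IsOpen {g : G ≃g G | g x = y} := by
  let : TopologicalSpace V := ⊥
  have : DiscreteTopology V := ⟨rfl⟩
  have hc : Continuous (fun g : G ≃g G => (g : V → V)) := continuous_induced_dom
  exact (isOpen_discrete {y}).preimage ((continuous_apply x).comp hc)

theorem continuous_const_mul_aut (h : G ≃g G) : Continuous fun g : G ≃g G => h * g := by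
  let : TopologicalSpace V := ⊥
  have : DiscreteTopology V := ⟨rfl⟩
  refine continuous_induced_rng.2 (continuous_pi fun v => ?_)
  have hc : Continuous (fun g : G ≃g G => (g : V → V)) := continuous_induced_dom
  exact (continuous_of_discreteTopology (f := (h : V → V))).comp ((continuous_apply v).comp hc)

theorem continuous_mul_const_aut (h : G ≃g G) : Continuous fun g : G ≃g G => g * h := by
  let : TopologicalSpace V := ⊥
  have : DiscreteTopology V := ⟨rfl⟩
  refine continuous_induced_rng.2 (continuous_pi fun v => ?_)
  have hc : Continuous (fun g : G ≃g G => (g : V → V)) := continuous_induced_dom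
  exact (continuous_apply (h v)).comp hc

theorem isCompact_stabilizer [G.LocallyFinite] (hconn : G.Connected) (o : V) :
    IsCompact {g : G ≃g G | g o = o} := by
  let : TopologicalSpace V := ⊥
  have : DiscreteTopology V := ⟨rfl⟩
  rw [isCompact_iff_ultrafilter_le_nhds]
  intro F hF
  rw [Filter.le_principal_iff] at hF
  -- Along the ultrafilter, a function of `g` with values in a finite set is eventually constant.
  have hlim : ∀ k : (G ≃g G) → V, (∃ S : Set V, S.Finite ∧ ∀ g : G ≃g G, g o = o → k g ∈ S) →
      ∃ y, ∀ᶠ g in (F : Filter (G ≃g G)), k g = y := by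
    rintro k ⟨S, hS, hk⟩
    have : (⋃ y ∈ S, {g : G ≃g G | k g = y}) ∈ F :=
      Filter.mem_of_superset hF fun g hg => by simpa using hk g hg
    obtain ⟨y, -, hy⟩ := (Ultrafilter.finite_biUnion_mem_iff hS).1 this
    exact ⟨y, hy⟩
  have hmap : ∀ (v : V), ∃ S : Set V, S.Finite ∧ ∀ g : G ≃g G, g o = o → g v ∈ S := fun v => by
    obtain ⟨w⟩ := hconn.preconnected o v
    refine ⟨_, finite_walk_endpoints (G := G) w.length o, fun g hg => ?_⟩
    exact ⟨(w.map g.toHom).copy hg rfl, by simp⟩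
  have h1 : ∀ v, ∃ y, ∀ᶠ g in (F : Filter (G ≃g G)), g v = y := fun v => hlim _ (hmap v)
  have h2 : ∀ v, ∃ y, ∀ᶠ g in (F : Filter (G ≃g G)), g.symm v = y := fun v => by
    obtain ⟨S, hS, h⟩ := hmap v
    refine hlim _ ⟨S, hS, fun g hg => h g.symm ?_⟩
    rw [RelIso.symm_apply_eq, hg]
  choose f hf using h1
  choose f' hf' using h2
  have hl : ∀ v, f' (f v) = v := fun v => by
    obtain ⟨g, hg, hg'⟩ := ((hf v).and (hf' (f v))).exists
    rw [← hg', ← hg]; simp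
  have hr : ∀ v, f (f' v) = v := fun v => by
    obtain ⟨g, hg, hg'⟩ := ((hf (f' v)).and (hf' v)).exists
    rw [← hg, ← hg']; simp
  let φ : G ≃g G := ⟨⟨f, f', hl, hr⟩, fun {a b} => by
    obtain ⟨g, hg, hg'⟩ := ((hf a).and (hf b)).exists
    change G.Adj (f a) (f b) ↔ _
    rw [← hg, ← hg', g.map_adj_iff]⟩
  refine ⟨φ, ?_, ?_⟩
  · obtain ⟨g, hg, hg'⟩ := ((hf o).and hF).exists
    change f o = o
    rw [← hg]; exact hg'
  · rw [nhds_induced, ← Filter.tendsto_iff_comap, tendsto_pi_nhds]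
    intro v
    rw [nhds_discrete, Filter.tendsto_pure]
    exact hf v

end Stabilizer

/-- The mass-transport principle. Against a bi-invariant Haar measure `μ`, both sides, multiplied by
the mass of the stabilizer of `o`, are equal to `∫ f o (g o) ∂μ = ∫ f (g⁻¹ o) o ∂μ`. -/
theorem mass_transport [G.LocallyFinite] (hconn : G.Connected) (hunim : IsUnimodular G)
    (htrans : IsTransitive G) {f : V → V → ENNReal}
    (hf : ∀ (φ : G ≃g G) (x y : V), f (φ x) (φ y) = f x y) (o : V) :
    ∑' y, f o y = ∑' y, f y o := by
  have := countable_of_connected hconn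
  let : TopologicalSpace (G ≃g G) := autTopology G
  let : MeasurableSpace (G ≃g G) := borel (G ≃g G)
  have : BorelSpace (G ≃g G) := ⟨rfl⟩
  have : MeasurableMul (G ≃g G) :=
    { measurable_const_mul := fun h => (continuous_const_mul_aut h).measurable
      measurable_mul_const := fun h => (continuous_mul_const_aut h).measurable }
  obtain ⟨μ, hμ, hμr⟩ := hunim
  let : MeasurableSpace V := ⊤
  have hm : ∀ x y : V, MeasurableSet {g : G ≃g G | g x = y} := fun x y =>
    (isOpen_apply_eq x y).measurableSet
  have hm1 : Measurable fun g : G ≃g G => g o :=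
    measurable_to_countable' fun y => hm o y
  have hm2 : Measurable fun g : G ≃g G => g⁻¹ o := by
    refine measurable_to_countable' fun y => ?_
    have : (fun g : G ≃g G => g⁻¹ o) ⁻¹' {y} = {g | g y = o} := by
      ext g
      simp only [Set.mem_preimage, Set.mem_singleton_iff]
      exact ⟨fun h => by rw [← h]; exact RelIso.apply_inv_self g o,
        fun h => by rw [← h]; exact RelIso.inv_apply_self g y⟩
    rw [this]
    exact hm y o
  set c := μ {g : G ≃g G | g o = o} with hc
  have hc0 : c ≠ 0 := (isOpen_apply_eq o o).measure_ne_zero μ ⟨1, rfl⟩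
  have hct : c ≠ ⊤ := (isCompact_stabilizer hconn o).measure_lt_top.ne
  have h1 : ∀ y, μ ((fun g : G ≃g G => g o) ⁻¹' {y}) = c := fun y => by
    obtain ⟨h, rfl⟩ := htrans o y
    rw [hc, ← measure_preimage_mul μ h⁻¹ {g | g o = o}]
    congr 1
    ext g
    simp only [Set.mem_preimage, Set.mem_singleton_iff]
    change g o = h o ↔ h⁻¹ (g o) = o
    exact ⟨fun e => by rw [e]; exact RelIso.inv_apply_self h o,
      fun e => by conv_rhs => rw [← e]
                  exact (RelIso.apply_inv_self h _).symm⟩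
  have h2 : ∀ y, μ ((fun g : G ≃g G => g⁻¹ o) ⁻¹' {y}) = c := fun y => by
    obtain ⟨h, rfl⟩ := htrans o y
    rw [hc, ← measure_preimage_mul_right μ h {g | g o = o}]
    congr 1
    ext g
    simp only [Set.mem_preimage, Set.mem_singleton_iff]
    change g⁻¹ o = h o ↔ g (h o) = o
    exact ⟨fun e => by rw [← e]; exact RelIso.apply_inv_self g o,
      fun e => by conv_lhs => rw [← e]
                  exact RelIso.inv_apply_self g _⟩
  have e1 : ∫⁻ g, f o (g o) ∂μ = (∑' y, f o y) * c := by
    rw [← lintegral_map (μ := μ) (f := fun y => f o y) (measurable_from_top) hm1,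
      lintegral_countable', ← ENNReal.tsum_mul_right]
    refine tsum_congr fun y => ?_
    rw [Measure.map_apply hm1 trivial, h1]
  have e2 : ∫⁻ g, f (g⁻¹ o) o ∂μ = (∑' y, f y o) * c := by
    rw [← lintegral_map (μ := μ) (f := fun y => f y o) (measurable_from_top) hm2,
      lintegral_countable', ← ENNReal.tsum_mul_right]
    refine tsum_congr fun y => ?_
    rw [Measure.map_apply hm2 trivial, h2]
  have e3 : ∀ g : G ≃g G, f o (g o) = f (g⁻¹ o) o := fun g => by
    rw [← hf g (g⁻¹ o) o, RelIso.apply_inv_self]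
  rw [lintegral_congr e3, e2] at e1
  exact ((ENNReal.mul_left_inj hc0 hct).1 e1).symm

end Automorphisms

/-! ### Infinite components and sides of edges -/

section Graphs

variable {V : Type*} {H H' : SimpleGraph V} {x y a b : V}

/-- The component of `x` in `H` is infinite. -/
def InfAt (H : SimpleGraph V) (x : V) : Prop :=
  {z | H.Reachable x z}.Infinite

theorem InfAt.mono (h : InfAt H x) (hle : H ≤ H') : InfAt H' x :=
  Set.Infinite.mono (fun _ hz => SimpleGraph.Reachable.mono hle hz) h

theorem InfAt.of_reachable (h : InfAt H x) (hxy : H.Reachable x y) : InfAt H y :=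
  Set.Infinite.mono (fun _ hz => hxy.symm.trans hz) h

/-- If `S` is closed under adjacency in `H`, and `H'` connects the endpoints of the edges of `H` in
`S`, then `H'` connects a point of `S` to all vertices to which `H` connects it. -/
theorem reachable_of_closed {S : V → Prop} (hx : S x)
    (hS : ∀ a b, S a → H.Adj a b → S b ∧ H'.Reachable a b) (h : H.Reachable x y) :
    S y ∧ H'.Reachable x y := by
  rw [SimpleGraph.reachable_iff_reflTransGen] at h
  induction h with
  | refl => exact ⟨hx, .refl _⟩
  | tail _ hbc ih => exact ⟨(hS _ _ ih.1 hbc).1, ih.2.trans (hS _ _ ih.1 hbc).2⟩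

/-- A walk from a vertex in `S` to one outside uses an edge leaving `S`. -/
theorem exists_adj_leaving {S : V → Prop} (hx : S x) (hy : ¬ S y) (h : H.Reachable x y) :
    ∃ a b, S a ∧ ¬ S b ∧ H.Adj a b ∧ H.Reachable x a := by
  by_contra! hcon
  refine hy (reachable_of_closed (H' := H) (S := fun z => S z ∧ H.Reachable x z)
    ⟨hx, .refl _⟩ ?_ h).1.1
  intro a b ha hab
  refine ⟨⟨?_, ha.2.trans hab.reachable⟩, hab.reachable⟩
  by_contra hb
  exact hcon a b ha.1 hb hab ha.2

theorem deleteEdge_adj {e : Sym2 V} :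
    (H.deleteEdges {e}).Adj x y ↔ H.Adj x y ∧ s(x, y) ≠ e := by
  simp [SimpleGraph.deleteEdges_adj]

theorem deleteEdge_le {e : Sym2 V} : H.deleteEdges {e} ≤ H := fun _ _ h =>
  (deleteEdge_adj.1 h).1

theorem reachable_deleteEdge (h : H.Reachable a x) :
    (H.deleteEdges {s(a, b)}).Reachable a x ∨ (H.deleteEdges {s(a, b)}).Reachable b x := by
  refine (reachable_of_closed (H' := H) (S := fun z =>
    (H.deleteEdges {s(a, b)}).Reachable a z ∨ (H.deleteEdges {s(a, b)}).Reachable b z)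
    (.inl (.refl _)) ?_ h).1
  intro c d hc hcd
  refine ⟨?_, hcd.reachable⟩
  by_cases he : s(c, d) = s(a, b)
  · rcases Sym2.eq_iff.1 he with ⟨-, rfl⟩ | ⟨-, rfl⟩
    · exact .inr (.refl _)
    · exact .inl (.refl _)
  · have : (H.deleteEdges {s(a, b)}).Adj c d := deleteEdge_adj.2 ⟨hcd, he⟩
    exact hc.imp (·.trans this.reachable) (·.trans this.reachable)

/-- The directed edge `a → b` of `H` points to infinity: the component of `b` in `H` without this
edge is infinite. -/
def ToInf (H : SimpleGraph V) (a b : V) : Prop :=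
  H.Adj a b ∧ InfAt (H.deleteEdges {s(a, b)}) b

theorem toInf_or_toInf (hab : H.Adj a b) (ha : InfAt H a) : ToInf H a b ∨ ToInf H b a := by
  by_contra! hcon
  simp only [ToInf, hab, hab.symm, true_and, InfAt, Set.not_infinite] at hcon
  rw [Sym2.eq_swap (a := b)] at hcon
  refine ha ((hcon.1.union hcon.2).subset fun z hz => ?_)
  exact (reachable_deleteEdge hz).symm

theorem exists_toInf (hfin : (H.neighborSet a).Finite) (ha : InfAt H a) : ∃ b, ToInf H a b := by
  classical
  by_contra! hcon
  refine ha ((((hfin.biUnion (t := fun b => {z | (H.deleteEdges {s(a, b)}).Reachable b z})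
    fun b hb => ?_)).insert a).subset ?_)
  · by_contra hinf
    exact hcon b ⟨hb, hinf⟩
  · intro z hz
    obtain ⟨p, hp⟩ := SimpleGraph.Reachable.exists_isPath hz
    cases p with
    | nil => exact .inl rfl
    | @cons _ b _ hab q =>
      refine .inr (Set.mem_biUnion (show b ∈ H.neighborSet a from hab) ?_)
      rw [SimpleGraph.Walk.cons_isPath_iff] at hp
      exact ⟨q.toDeleteEdge _ fun he => hp.2 (q.fst_mem_support_of_mem_edges he)⟩

/-- In a locally finite graph, past a directed edge that points to infinity there is another. -/
theorem ToInf.exists_next (hfin : (H.neighborSet b).Finite) (h : ToInf H a b) :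
    ∃ c, c ≠ a ∧ ToInf H b c := by
  have hfin' : ((H.deleteEdges {s(a, b)}).neighborSet b).Finite :=
    hfin.subset fun c (hc : (H.deleteEdges {s(a, b)}).Adj b c) => (deleteEdge_adj.1 hc).1
  obtain ⟨c, hbc, hc⟩ := exists_toInf hfin' h.2
  obtain ⟨hbc, hne⟩ := deleteEdge_adj.1 hbc
  refine ⟨c, ?_, hbc, hc.mono ?_⟩
  · rintro rfl
    exact hne Sym2.eq_swap
  · intro u v huv
    obtain ⟨h1, h2⟩ := deleteEdge_adj.1 huv
    exact deleteEdge_adj.2 ⟨(deleteEdge_adj.1 h1).1, h2⟩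

open Classical in
/-- How much of the two half-edges of `ab` is counted at `a`: both when only `a → b` points to
infinity, one when both directions do, none otherwise. -/
noncomputable def outWeight (H : SimpleGraph V) (a b : V) : ENNReal :=
  if ToInf H a b then (if ToInf H b a then 1 else 2) else 0

open Classical in
/-- The indicator of a proposition. -/
noncomputable def ind (p : Prop) : ENNReal := if p then 1 else 0

theorem ind_true {p : Prop} (h : p) : ind p = 1 := if_pos h

theorem ind_false {p : Prop} (h : ¬ p) : ind p = 0 := if_neg h

theorem ind_le_one (p : Prop) : ind p ≤ 1 := by
  unfold ind; split_ifs <;> simp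

theorem ind_congr {p q : Prop} (h : p ↔ q) : ind p = ind q := by rw [propext h]

theorem tsum_ind_le_one {α : Type*} {p : α → Prop} (h : ∀ a b, p a → p b → a = b) :
    ∑' a, ind (p a) ≤ 1 := by
  by_cases hex : ∃ a, p a
  · obtain ⟨a, ha⟩ := hex
    rw [tsum_eq_single a fun b hb => ind_false fun hpb => hb (h b a hpb ha)]
    exact ind_le_one _
  · push Not at hex
    simp [ind_false (hex _)]

theorem outWeight_add (ha : InfAt H a) :
    outWeight H a b + outWeight H b a = 2 * ind (H.Adj a b) := by
  by_cases hab : H.Adj a b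
  · rw [ind_true hab]
    rcases toInf_or_toInf hab ha with h | h <;> by_cases h' : ToInf H a b <;>
      by_cases h'' : ToInf H b a <;> simp_all [outWeight] <;> norm_num
  · rw [ind_false hab]
    have h1 : ¬ ToInf H a b := fun h => hab h.1
    have h2 : ¬ ToInf H b a := fun h => hab h.1.symm
    simp [outWeight, h1, h2]

theorem add_le_tsum {α : Type*} (f : α → ENNReal) {c d : α} (hcd : c ≠ d) :
    f c + f d ≤ ∑' b, f b := by
  classical
  have := ENNReal.sum_le_tsum (f := f) {c, d}
  rwa [Finset.sum_pair hcd] at this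

theorem one_le_outWeight (h : ToInf H a b) : 1 ≤ outWeight H a b := by
  rw [outWeight, if_pos h]
  split_ifs <;> norm_num

/-- At a vertex with an infinite component, the weight is at least two: if `a → c` points to
infinity and `c → a` does too, then so does another directed edge at `a`. -/
theorem two_le_tsum_outWeight (hfin : (H.neighborSet a).Finite) (ha : InfAt H a) :
    2 ≤ ∑' b, outWeight H a b := by
  obtain ⟨c, hc⟩ := exists_toInf hfin ha
  by_cases hc' : ToInf H c a
  · obtain ⟨d, hd, hd'⟩ := hc'.exists_next hfin
    refine le_trans ?_ (add_le_tsum _ hd.symm)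
    rw [← one_add_one_eq_two]
    gcongr
    · exact one_le_outWeight hc
    · exact one_le_outWeight hd'
  · refine le_trans ?_ (ENNReal.le_tsum c)
    simp [outWeight, hc, hc']

/-- A permutation of the vertices that is an isomorphism from `H` to `H'`. -/
def MapsTo (φ : V ≃ V) (H H' : SimpleGraph V) : Prop :=
  ∀ x y, H.Adj x y ↔ H'.Adj (φ x) (φ y)

variable {φ : V ≃ V}

theorem MapsTo.reachable (h : MapsTo φ H H') :
    H.Reachable x y ↔ H'.Reachable (φ x) (φ y) := by
  let e : H ≃g H' := ⟨φ, fun {a b} => (h a b).symm⟩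
  exact (SimpleGraph.Iso.reachable_iff (φ := e)).symm

theorem MapsTo.infAt (h : MapsTo φ H H') : InfAt H x ↔ InfAt H' (φ x) := by
  have : {z | H'.Reachable (φ x) z} = φ '' {z | H.Reachable x z} := by
    ext z
    simp only [Set.mem_image, Set.mem_ofPred_eq]
    refine ⟨fun hz => ⟨φ.symm z, ?_, by simp⟩, ?_⟩
    · rw [h.reachable]; simpa using hz
    · rintro ⟨w, hw, rfl⟩; exact h.reachable.1 hw
  rw [InfAt, InfAt, this, Set.infinite_image_iff φ.injective.injOn]

theorem MapsTo.deleteEdge (h : MapsTo φ H H') :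
    MapsTo φ (H.deleteEdges {s(a, b)}) (H'.deleteEdges {s(φ a, φ b)}) := fun x y => by
  rw [deleteEdge_adj, deleteEdge_adj, h x y]
  refine and_congr_right fun _ => not_congr ?_
  rw [← Sym2.map_mk φ x y, ← Sym2.map_mk φ a b, (Sym2.map.injective φ.injective).eq_iff]

theorem MapsTo.toInf (h : MapsTo φ H H') : ToInf H a b ↔ ToInf H' (φ a) (φ b) :=
  and_congr (h a b) h.deleteEdge.infAt

theorem MapsTo.outWeight (h : MapsTo φ H H') :
    outWeight H a b = outWeight H' (φ a) (φ b) := by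
  have h1 : ToInf H a b ↔ ToInf H' (φ a) (φ b) := h.toInf
  have h2 : ToInf H b a ↔ ToInf H' (φ b) (φ a) := h.toInf
  by_cases k1 : ToInf H' (φ a) (φ b) <;> by_cases k2 : ToInf H' (φ b) (φ a) <;>
    simp [MinimalForest.outWeight, h1, h2, k1, k2]

end Graphs

/-! ### Random subgraphs -/

section RandomSubgraphs

variable {V : Type*} {G : SimpleGraph V}

/-- Indices of the labels: two independent families, each indexed by all unordered pairs of
vertices. The pairs that are not edges are irrelevant, except that the label of `s(v, v)` in the
first family serves as an independent label of the vertex `v`. -/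
abbrev Index (V : Type*) := Sym2 V ⊕ Sym2 V

/-- The configuration space: a uniform label for each index. -/
abbrev Config (V : Type*) := Index V → unitInterval

/-- The action of a permutation of the vertices on the indices. -/
def permIndex (φ : V ≃ V) : Index V ≃ Index V where
  toFun := Sum.map (Sym2.map φ) (Sym2.map φ)
  invFun := Sum.map (Sym2.map φ.symm) (Sym2.map φ.symm)
  left_inv i := by cases i <;> simp [Sym2.map_map]
  right_inv i := by cases i <;> simp [Sym2.map_map]

/-- The action of a permutation of the vertices on configurations. -/
def shift (φ : V ≃ V) (ω : Config V) : Config V := fun i => ω (permIndex φ i)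

@[simp] theorem shift_inl (φ : V ≃ V) (ω : Config V) (x y : V) :
    shift φ ω (.inl s(x, y)) = ω (.inl s(φ x, φ y)) := rfl

@[simp] theorem shift_inr (φ : V ≃ V) (ω : Config V) (x y : V) :
    shift φ ω (.inr s(x, y)) = ω (.inr s(φ x, φ y)) := rfl

theorem measurePreserving_shift (φ : V ≃ V) :
    MeasurePreserving (shift φ) (unif (Index V)) (unif (Index V)) :=
  measurePreserving_unif_comp (permIndex φ).injective

/-- Ergodicity of the labels under the automorphisms of an infinite transitive graph. -/
theorem zero_or_one_of_shift [G.LocallyFinite] [Infinite V] (hconn : G.Connected)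
    (htrans : IsTransitive G) {A : Set (Config V)} (hA : MeasurableSet A)
    (h : ∀ (φ : G ≃g G) ω, shift φ.toEquiv ω ∈ A ↔ ω ∈ A) :
    unif (Index V) A = 0 ∨ unif (Index V) A = 1 := by
  classical
  refine unif_zero_or_one hA fun S => ?_
  let supp : Index V → Finset V := Sum.elim Sym2.toFinset Sym2.toFinset
  obtain ⟨φ, hφ⟩ := exists_aut_disjoint hconn htrans (S.biUnion supp)
  refine ⟨permIndex φ.toEquiv, fun i hi hi' => ?_, h φ⟩
  have : ∃ x, x ∈ supp i ∧ φ x ∈ supp (permIndex φ.toEquiv i) := by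
    rcases i with e | e <;> induction e with | _ x y =>
      exact ⟨x, by simp [supp], by simp [supp, permIndex]⟩
  obtain ⟨x, hx, hx'⟩ := this
  exact hφ x (Finset.mem_biUnion.2 ⟨i, hi, hx⟩) (Finset.mem_biUnion.2 ⟨_, hi', hx'⟩)

section Measurability

variable {Ω : Type*} [MeasurableSpace Ω] {H : Ω → SimpleGraph V}

theorem measurable_reachable [Countable V] (hH : ∀ x y, Measurable fun ω => (H ω).Adj x y)
    (x y : V) : Measurable fun ω => (H ω).Reachable x y := by
  -- Reachability by exactly `n` steps, as a recursion on `n`.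
  let R : ℕ → V → Ω → Prop := fun n => n.rec (fun z _ => x = z)
    (fun _ R z ω => ∃ w, R w ω ∧ (H ω).Adj w z)
  have hR : ∀ n z, Measurable (R n z) := by
    intro n
    induction n with
    | zero => intro z; exact measurable_const
    | succ n ih => intro z; exact Measurable.exists fun w => (ih w).and (hH w z)
  have : (fun ω => (H ω).Reachable x y) = fun ω => ∃ n, R n y ω := by
    ext ω
    constructor
    · intro h
      rw [SimpleGraph.reachable_iff_reflTransGen] at h
      induction h with
      | refl => exact ⟨0, rfl⟩
      | tail _ hbc ih => obtain ⟨n, hn⟩ := ih; exact ⟨n + 1, _, hn, hbc⟩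
    · rintro ⟨n, hn⟩
      induction n generalizing y with
      | zero => obtain rfl : x = y := hn; exact .refl _
      | succ n ih => obtain ⟨w, hw, hwy⟩ := hn; exact (ih w hw).trans hwy.reachable
  rw [this]
  exact Measurable.exists fun n => hR n y

theorem measurable_infAt [Countable V] (hH : ∀ x y, Measurable fun ω => (H ω).Adj x y)
    (x : V) : Measurable fun ω => InfAt (H ω) x := by
  have : (fun ω => InfAt (H ω) x) = fun ω => ∀ s : Finset V, ∃ z, z ∉ s ∧ (H ω).Reachable x z := by
    ext ω
    constructor
    · intro h s
      obtain ⟨z, hz, hzs⟩ := Set.Infinite.exists_notMem_finset h s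
      exact ⟨z, hzs, hz⟩
    · intro h hfin
      obtain ⟨z, hz, hxz⟩ := h hfin.toFinset
      exact hz (hfin.mem_toFinset.2 hxz)
  rw [this]
  exact Measurable.forall fun s => Measurable.exists fun z =>
    measurable_const.and (measurable_reachable hH x z)

theorem measurable_deleteEdge (hH : ∀ x y, Measurable fun ω => (H ω).Adj x y) (e : Sym2 V)
    (x y : V) : Measurable fun ω => ((H ω).deleteEdges {e}).Adj x y := by
  simp only [deleteEdge_adj]
  exact (hH x y).and measurable_const

theorem measurable_ind {p : Ω → Prop} (hp : Measurable p) : Measurable fun ω => ind (p ω) := by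
  classical
  exact Measurable.ite (measurableSet_setOfPred.2 hp) measurable_const measurable_const

theorem lintegral_ind {μ : Measure Ω} {p : Ω → Prop} (hp : Measurable p) :
    ∫⁻ ω, ind (p ω) ∂μ = μ {ω | p ω} := by
  classical
  rw [← lintegral_indicator_one (measurableSet_setOfPred.2 hp)]
  refine lintegral_congr fun ω => ?_
  by_cases h : p ω
  · rw [ind_true h, Set.indicator_of_mem (show ω ∈ {ω | p ω} from h)]; rfl
  · rw [ind_false h, Set.indicator_of_notMem (show ω ∉ {ω | p ω} from h)]

theorem measurable_toInf [Countable V] (hH : ∀ x y, Measurable fun ω => (H ω).Adj x y) (x y : V) :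
    Measurable fun ω => ToInf (H ω) x y :=
  (hH x y).and (measurable_infAt (measurable_deleteEdge hH _) y)

theorem measurable_outWeight [Countable V] (hH : ∀ x y, Measurable fun ω => (H ω).Adj x y)
    (x y : V) : Measurable fun ω => outWeight (H ω) x y := by
  classical
  exact Measurable.ite (measurableSet_setOfPred.2 (measurable_toInf hH x y))
    (Measurable.ite (measurableSet_setOfPred.2 (measurable_toInf hH y x)) measurable_const
      measurable_const) measurable_const

end Measurability

/-- The mass-transport principle for a random, diagonally invariant transport. -/
theorem lintegral_mass_transport [G.LocallyFinite] (hconn : G.Connected) (hunim : IsUnimodular G)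
    (htrans : IsTransitive G) {F : Config V → V → V → ENNReal}
    (hm : ∀ x y, Measurable fun ω => F ω x y)
    (hF : ∀ (φ : G ≃g G) ω x y, F (shift φ.toEquiv ω) x y = F ω (φ x) (φ y)) (o : V) :
    ∫⁻ ω, ∑' y, F ω o y ∂unif (Index V) = ∫⁻ ω, ∑' y, F ω y o ∂unif (Index V) := by
  have := countable_of_connected hconn
  rw [lintegral_tsum fun y => (hm o y).aemeasurable, lintegral_tsum fun y => (hm y o).aemeasurable]
  refine mass_transport hconn hunim htrans (f := fun x y => ∫⁻ ω, F ω x y ∂unif (Index V))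
    (fun φ x y => ?_) o
  rw [← lintegral_congr fun ω => hF φ ω x y]
  exact (measurePreserving_shift φ.toEquiv).lintegral_comp (hm x y)

/-- A measurable random subgraph of `G`, equivariant under the automorphisms of `G`. -/
structure IsRandomSubgraph (G : SimpleGraph V) (H : Config V → SimpleGraph V) : Prop where
  le : ∀ ω, H ω ≤ G
  meas : ∀ x y, Measurable fun ω => (H ω).Adj x y
  equiv : ∀ (φ : G ≃g G) ω, MapsTo φ.toEquiv (H (shift φ.toEquiv ω)) (H ω)

/-- The expected degree of the vertex `o` in a random graph. -/
noncomputable def expDegree (H : Config V → SimpleGraph V) (o : V) : ENNReal :=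
  ∫⁻ ω, ∑' y, ind ((H ω).Adj o y) ∂unif (Index V)

theorem expDegree_eq_tsum [Countable V] {H : Config V → SimpleGraph V}
    (hH : ∀ x y, Measurable fun ω => (H ω).Adj x y) (o : V) :
    expDegree H o = ∑' y, unif (Index V) {ω | (H ω).Adj o y} := by
  rw [expDegree, lintegral_tsum fun y => (measurable_ind (hH o y)).aemeasurable]
  exact tsum_congr fun y => lintegral_ind (hH o y)

variable {H : Config V → SimpleGraph V}

/-- When all components are infinite, mass transport turns the degree into the total outward
weight. -/
theorem expDegree_eq_lintegral_outWeight [G.LocallyFinite] (hconn : G.Connected)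
    (hunim : IsUnimodular G) (htrans : IsTransitive G) (hH : IsRandomSubgraph G H)
    (hinf : ∀ᵐ ω ∂unif (Index V), ∀ x, InfAt (H ω) x) (o : V) :
    expDegree H o = ∫⁻ ω, ∑' y, outWeight (H ω) o y ∂unif (Index V) := by
  have := countable_of_connected hconn
  have hm := fun x y => measurable_outWeight hH.meas x y
  have key : 2 * expDegree H o = 2 * ∫⁻ ω, ∑' y, outWeight (H ω) o y ∂unif (Index V) := by
    rw [two_mul (∫⁻ ω, _ ∂_)]
    conv_rhs => lhs; rw [lintegral_mass_transport hconn hunim htrans hm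
      (fun φ ω x y => (hH.equiv φ ω).outWeight) o]
    rw [← lintegral_add_left (Measurable.tsum fun y => hm y o), expDegree,
      ← lintegral_const_mul _ (Measurable.tsum fun y => measurable_ind (hH.meas o y))]
    refine lintegral_congr_ae ?_
    filter_upwards [hinf] with ω hω
    rw [← ENNReal.tsum_add, ← ENNReal.tsum_mul_left]
    refine tsum_congr fun y => ?_
    rw [add_comm, outWeight_add (hω o)]
  exact (ENNReal.mul_right_inj (by norm_num) (by norm_num)).1 key

theorem neighborSet_finite [G.LocallyFinite] {H : SimpleGraph V} (hle : H ≤ G) (x : V) :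
    (H.neighborSet x).Finite :=
  (Set.toFinite (G.neighborSet x)).subset fun _ hy => hle hy

theorem two_le_expDegree [G.LocallyFinite] (hconn : G.Connected)
    (hunim : IsUnimodular G) (htrans : IsTransitive G) (hH : IsRandomSubgraph G H)
    (hinf : ∀ᵐ ω ∂unif (Index V), ∀ x, InfAt (H ω) x) (o : V) : 2 ≤ expDegree H o := by
  rw [expDegree_eq_lintegral_outWeight hconn hunim htrans hH hinf]
  calc (2 : ENNReal) = ∫⁻ _, 2 ∂unif (Index V) := by simp
    _ ≤ _ := lintegral_mono_ae (by
      filter_upwards [hinf] with ω hω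
      exact two_le_tsum_outWeight (neighborSet_finite (hH.le ω) o) (hω o))

/-- When the expected degree is at most two, the total outward weight of every vertex is exactly
two: each component then has at most two ends. -/
theorem ae_tsum_outWeight_eq_two [G.LocallyFinite] (hconn : G.Connected)
    (hunim : IsUnimodular G) (htrans : IsTransitive G) (hH : IsRandomSubgraph G H)
    (hinf : ∀ᵐ ω ∂unif (Index V), ∀ x, InfAt (H ω) x) (hdeg : ∀ o, expDegree H o ≤ 2) :
    ∀ᵐ ω ∂unif (Index V), ∀ x, ∑' y, outWeight (H ω) x y = 2 := by
  have := countable_of_connected hconn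
  rw [ae_all_iff]
  intro o
  have h1 := hdeg o
  rw [expDegree_eq_lintegral_outWeight hconn hunim htrans hH hinf] at h1
  have h2 : (fun _ : Config V => (2 : ENNReal)) ≤ᵐ[unif (Index V)]
      fun ω => ∑' y, outWeight (H ω) o y := by
    filter_upwards [hinf] with ω hω
    exact two_le_tsum_outWeight (neighborSet_finite (hH.le ω) o) (hω o)
  have h3 := ae_eq_of_ae_le_of_lintegral_le h2 (by simp)
    (Measurable.tsum fun y => measurable_outWeight hH.meas o y).aemeasurable (by simpa using h1)
  filter_upwards [h3] with ω hω
  exact hω.symm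

end RandomSubgraphs

/-! ### Merging finite clusters: an upper bound for the expected degree -/

section Merging

variable {V : Type*} {G H H' : SimpleGraph V} {u u' : Sym2 V → unitInterval}
  {s t : unitInterval} {x y v : V}

/-- The subgraph of the edges of `H` with label less than `t`. -/
def below (H : SimpleGraph V) (u : Sym2 V → unitInterval) (t : unitInterval) :
    SimpleGraph V where
  Adj x y := H.Adj x y ∧ u s(x, y) < t
  symm := ⟨fun x y h => ⟨h.1.symm, by rw [Sym2.eq_swap]; exact h.2⟩⟩
  loopless := ⟨fun x h => H.loopless.irrefl x h.1⟩

theorem below_le : below H u t ≤ H := fun _ _ h => h.1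

theorem below_mono (h : H ≤ H') (hst : s ≤ t) : below H u s ≤ below H' u t :=
  fun _ _ hab => ⟨h hab.1, hab.2.trans_le hst⟩

theorem MapsTo.below {φ : V ≃ V} (h : MapsTo φ H H')
    (hu : ∀ x y, u s(x, y) = u' s(φ x, φ y)) (t : unitInterval) :
    MapsTo φ (below H u t) (below H' u' t) := fun x y =>
  and_congr (h x y) (by rw [hu])

theorem measurable_below {Ω : Type*} [MeasurableSpace Ω] {H : Ω → SimpleGraph V}
    {u : Ω → Sym2 V → unitInterval} {t : Ω → unitInterval}
    (hH : ∀ x y, Measurable fun ω => (H ω).Adj x y) (hu : ∀ e, Measurable fun ω => u ω e)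
    (ht : Measurable t) (x y : V) : Measurable fun ω => (below (H ω) (u ω) (t ω)).Adj x y :=
  (hH x y).and (measurableSet_setOfPred.1 (measurableSet_lt (hu _) ht))

/-- The first family of labels. -/
def label (ω : Config V) (e : Sym2 V) : unitInterval := ω (.inl e)

/-- The second family of labels. -/
def label' (ω : Config V) (e : Sym2 V) : unitInterval := ω (.inr e)

@[fun_prop]
theorem measurable_label (e : Sym2 V) : Measurable fun ω : Config V => label ω e :=
  measurable_pi_apply _

@[fun_prop]
theorem measurable_label' (e : Sym2 V) : Measurable fun ω : Config V => label' ω e :=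
  measurable_pi_apply _

/-- The leader of a finite set of vertices is its member with the smallest vertex label. When the
edge `xy` is added to the edges of smaller label, it merges the clusters of `x` and `y`. It kills the
vertex `v` on the side of `x` if `v` is the leader of the finite cluster of `x` and the cluster of
`y` is infinite or contains a vertex with a smaller vertex label. -/
def Kills (H : SimpleGraph V) (u : Sym2 V → unitInterval) (x y v : V) : Prop :=
  H.Adj x y ∧ ¬ InfAt (below H u (u s(x, y))) x ∧ (below H u (u s(x, y))).Reachable x v ∧
    (∀ z, (below H u (u s(x, y))).Reachable x z → u s(v, v) ≤ u s(z, z)) ∧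
    (InfAt (below H u (u s(x, y))) y ∨
      ∃ z, (below H u (u s(x, y))).Reachable y z ∧ u s(z, z) < u s(v, v))

theorem MapsTo.kills {φ : V ≃ V} (h : MapsTo φ H H')
    (hu : ∀ x y, u s(x, y) = u' s(φ x, φ y)) :
    Kills H u x y v ↔ Kills H' u' (φ x) (φ y) (φ v) := by
  have hb := h.below hu
  simp only [Kills, h x y, hu, (hb _).infAt, (hb _).reachable]
  rw [φ.forall_congr_left (p := fun z => (MinimalForest.below H' u' (u' s(φ x, φ y))).Reachable
      (φ x) (φ z) → u' s(φ v, φ v) ≤ u' s(φ z, φ z)),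
    φ.exists_congr_left (p := fun z => (MinimalForest.below H' u' (u' s(φ x, φ y))).Reachable
      (φ y) (φ z) ∧ u' s(φ z, φ z) < u' s(φ v, φ v))]
  simp

theorem measurable_kills {Ω : Type*} [MeasurableSpace Ω] [Countable V] {H : Ω → SimpleGraph V}
    {u : Ω → Sym2 V → unitInterval}
    (hH : ∀ x y, Measurable fun ω => (H ω).Adj x y) (hu : ∀ e, Measurable fun ω => u ω e)
    (x y v : V) : Measurable fun ω => Kills (H ω) (u ω) x y v := by
  have hb := measurable_below hH hu (hu s(x, y))
  refine (hH x y).and ((measurable_infAt hb x).not.and ((measurable_reachable hb x v).and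
    (Measurable.and (Measurable.forall fun z => (measurable_reachable hb x z).imp ?_)
      ((measurable_infAt hb y).or (Measurable.exists fun z =>
        (measurable_reachable hb y z).and ?_)))))
  · exact measurableSet_setOfPred.1 (measurableSet_le (hu _) (hu _))
  · exact measurableSet_setOfPred.1 (measurableSet_lt (hu _) (hu _))

theorem exists_leader (u : Sym2 V → unitInterval) (h : ¬ InfAt H x) :
    ∃ v, H.Reachable x v ∧ ∀ z, H.Reachable x z → u s(v, v) ≤ u s(z, z) :=
  Set.exists_min_image _ (fun v => u s(v, v)) (Set.not_infinite.1 h)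
    ⟨x, SimpleGraph.Reachable.refl x⟩

/-- Every edge merging two different clusters, one of them finite, kills a vertex. -/
theorem exists_kills (hinj : Function.Injective u) (hxy : H.Adj x y)
    (hn : ¬ (below H u (u s(x, y))).Reachable x y)
    (hf : ¬ InfAt (below H u (u s(x, y))) x ∨ ¬ InfAt (below H u (u s(x, y))) y) :
    ∃ v, Kills H u x y v ∨ Kills H u y x v := by
  wlog hx : ¬ InfAt (below H u (u s(x, y))) x generalizing x y
  · have hswap : s(x, y) = s(y, x) := Sym2.eq_swap
    obtain ⟨v, hv⟩ := this hxy.symm (by rw [← hswap]; exact fun h => hn h.symm)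
      (by rw [← hswap]; exact hf.symm) (by rw [← hswap]; exact hf.resolve_left hx)
    exact ⟨v, hv.symm⟩
  obtain ⟨v, hv, hv'⟩ := exists_leader u hx
  by_cases hy : InfAt (below H u (u s(x, y))) y
  · exact ⟨v, .inl ⟨hxy, hx, hv, hv', .inl hy⟩⟩
  obtain ⟨w, hw, hw'⟩ := exists_leader u hy
  rcases lt_trichotomy (u s(w, w)) (u s(v, v)) with h | h | h
  · exact ⟨v, .inl ⟨hxy, hx, hv, hv', .inr ⟨w, hw, h⟩⟩⟩
  · have : w = v := by simpa using hinj h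
    subst this
    exact absurd (hv.trans hw.symm) hn
  · refine ⟨w, .inr ?_⟩
    unfold Kills
    rw [Sym2.eq_swap (a := y)]
    exact ⟨hxy.symm, hy, hw, hw', .inr ⟨v, hv, h⟩⟩

/-- A vertex is killed only once: afterwards, its cluster is infinite or has another leader. -/
theorem Kills.unique {x' y' : V} (hinj : Function.Injective u)
    (hn : ∀ x y, H.Adj x y → ¬ (below H u (u s(x, y))).Reachable x y)
    (h : Kills H u x y v) (h' : Kills H u x' y' v) : x = x' ∧ y = y' := by
  wlog hle : u s(x, y) ≤ u s(x', y') generalizing x y x' y'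
  · obtain ⟨h1, h2⟩ := this h' h (le_of_not_ge hle)
    exact ⟨h1.symm, h2.symm⟩
  obtain ⟨hxy, -, hv, -, hy⟩ := h
  obtain ⟨-, hx', hv', hlead, -⟩ := h'
  rcases hle.eq_or_lt with heq | hlt
  · rcases Sym2.eq_iff.1 (hinj heq) with h | ⟨rfl, rfl⟩
    · exact h
    · rw [← heq] at hv'
      exact absurd (hv.trans hv'.symm) (hn _ _ hxy)
  · exfalso
    have hmono : below H u (u s(x, y)) ≤ below H u (u s(x', y')) := below_mono le_rfl hle
    have hadj : (below H u (u s(x', y'))).Adj x y := ⟨hxy, hlt⟩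
    have hr : (below H u (u s(x', y'))).Reachable x' y :=
      hv'.trans ((hv.mono hmono).symm.trans hadj.reachable)
    rcases hy with hy | ⟨z, hz, hlt'⟩
    · exact hx' ((hy.mono hmono).of_reachable hr.symm)
    · exact absurd (hlead z (hr.trans (hz.mono hmono))) (not_le.2 hlt')

/-- If every edge of a random graph `H` joins two different clusters of the edges of `H` with
smaller label, at least one of them finite, then the expected degree is at most two: each edge kills
a vertex, and each vertex is killed at most once. -/
theorem expDegree_le_two [G.LocallyFinite] (hconn : G.Connected)
    (hunim : IsUnimodular G) (htrans : IsTransitive G) {H : Config V → SimpleGraph V}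
    (hH : IsRandomSubgraph G H)
    (hmerge : ∀ᵐ ω ∂unif (Index V), ∀ x y, (H ω).Adj x y →
      ¬ (below (H ω) (label ω) (label ω s(x, y))).Reachable x y ∧
      (¬ InfAt (below (H ω) (label ω) (label ω s(x, y))) x ∨
        ¬ InfAt (below (H ω) (label ω) (label ω s(x, y))) y)) (o : V) :
    expDegree H o ≤ 2 := by
  have := countable_of_connected hconn
  have hk : ∀ x y v, Measurable fun ω : Config V => ind (Kills (H ω) (label ω) x y v) :=
    fun x y v => measurable_ind (measurable_kills hH.meas (fun e => by fun_prop) x y v)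
  -- The vertex `x` sends mass to `v` for each incident edge that kills `v`.
  let F : Config V → V → V → ENNReal := fun ω x v =>
    ∑' y, (ind (Kills (H ω) (label ω) x y v) + ind (Kills (H ω) (label ω) y x v))
  have hF : ∀ x v, Measurable fun ω => F ω x v := fun x v =>
    Measurable.tsum fun y => (hk x y v).add (hk y x v)
  have hFe : ∀ (φ : G ≃g G) ω x v, F (shift φ.toEquiv ω) x v = F ω (φ x) (φ v) := by
    intro φ ω x v
    have hu : ∀ x y, label (shift φ.toEquiv ω) s(x, y) = label ω s(φ.toEquiv x, φ.toEquiv y) :=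
      fun _ _ => rfl
    simp only [F, (hH.equiv φ ω).kills hu]
    exact φ.toEquiv.tsum_eq (fun y => ind (Kills (H ω) (label ω) (φ x) y (φ v)) +
      ind (Kills (H ω) (label ω) y (φ x) (φ v)))
  have hinj : ∀ᵐ ω ∂unif (Index V), Function.Injective (label ω) := by
    filter_upwards [ae_injective_unif (α := Index V)] with ω hω
    exact hω.comp Sum.inl_injective
  calc expDegree H o ≤ ∫⁻ ω, ∑' v, F ω o v ∂unif (Index V) := by
        refine lintegral_mono_ae ?_
        filter_upwards [hmerge, hinj] with ω hω hi
        rw [ENNReal.tsum_comm]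
        refine ENNReal.tsum_le_tsum fun y => ?_
        by_cases hoy : (H ω).Adj o y
        · obtain ⟨v, hv⟩ := exists_kills hi hoy (hω o y hoy).1 (hω o y hoy).2
          refine le_trans ?_ (ENNReal.le_tsum v)
          rw [ind_true hoy]
          rcases hv with hv | hv <;> simp [ind_true hv]
        · simp [ind_false hoy]
    _ = ∫⁻ ω, ∑' x, F ω x o ∂unif (Index V) :=
        lintegral_mass_transport hconn hunim htrans hF hFe o
    _ ≤ ∫⁻ _, 2 ∂unif (Index V) := by
        refine lintegral_mono_ae ?_
        filter_upwards [hmerge, hinj] with ω hω hi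
        simp only [F, ENNReal.tsum_add]
        rw [ENNReal.tsum_comm (f := fun x y => ind (Kills (H ω) (label ω) y x o)),
          ← two_mul, ← ENNReal.tsum_prod]
        refine (mul_le_mul_right (tsum_ind_le_one (p := fun p : V × V =>
          Kills (H ω) (label ω) p.1 p.2 o) ?_) 2).trans (by simp)
        rintro ⟨x, y⟩ ⟨x', y'⟩ h h'
        obtain ⟨h1, h2⟩ := Kills.unique hi (fun x y hxy => (hω x y hxy).1) h h'
        exact Prod.ext h1 h2
    _ = 2 := by simp

end Merging

/-! ### The free and wired forests -/

section Forests

variable {V : Type*} {G G' : SimpleGraph V} {u u' : Sym2 V → unitInterval} {x y a b : V}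

/-- The free minimal spanning forest for labels on all unordered pairs of vertices: an edge belongs
to it if the edges of smaller label do not connect its endpoints. -/
def forest (G : SimpleGraph V) (u : Sym2 V → unitInterval) : SimpleGraph V where
  Adj x y := G.Adj x y ∧ ¬ (below G u (u s(x, y))).Reachable x y
  symm := ⟨fun x y h => ⟨h.1.symm, by rw [Sym2.eq_swap]; exact fun h' => h.2 h'.symm⟩⟩
  loopless := ⟨fun x h => G.loopless.irrefl x h.1⟩

/-- The wired minimal spanning forest: at least one of the clusters joined by the edge is finite. -/
def wiredForest (G : SimpleGraph V) (u : Sym2 V → unitInterval) : SimpleGraph V where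
  Adj x y := (forest G u).Adj x y ∧
    ¬ (InfAt (below G u (u s(x, y))) x ∧ InfAt (below G u (u s(x, y))) y)
  symm := ⟨fun x y h => ⟨h.1.symm, by rw [Sym2.eq_swap]; exact fun h' => h.2 h'.symm⟩⟩
  loopless := ⟨fun x h => G.loopless.irrefl x h.1.1⟩

theorem forest_le : forest G u ≤ G := fun _ _ h => h.1

theorem wiredForest_le : wiredForest G u ≤ forest G u := fun _ _ h => h.1

theorem freeForest_eq_forest (u : Sym2 V → unitInterval) :
    freeForest G (fun e => u e) = forest G u := by
  ext x y
  constructor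
  · rintro ⟨hxy, h⟩
    refine ⟨hxy, ?_⟩
    rintro ⟨w⟩
    obtain ⟨e, he, hle⟩ := h (w.mapLe below_le)
    rw [SimpleGraph.Walk.edges_mapLe_eq_edges] at he
    obtain ⟨e, he'⟩ := e
    induction e with
    | _ a b => exact absurd (w.adj_of_mem_edges he).2 (not_lt.2 hle)
  · rintro ⟨hxy, h⟩
    refine ⟨hxy, fun w => ?_⟩
    by_contra! hcon
    refine h ⟨w.transfer _ fun e he => ?_⟩
    have heG := w.edges_subset_edgeSet he
    have := hcon ⟨e, heG⟩ he
    induction e with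
    | _ a b => exact ⟨heG, this⟩

theorem MapsTo.forest {φ : V ≃ V} (h : MapsTo φ G G')
    (hu : ∀ x y, u s(x, y) = u' s(φ x, φ y)) : MapsTo φ (forest G u) (forest G' u') :=
  fun x y => and_congr (h x y) (by rw [(h.below hu _).reachable, hu])

theorem MapsTo.wiredForest {φ : V ≃ V} (h : MapsTo φ G G')
    (hu : ∀ x y, u s(x, y) = u' s(φ x, φ y)) : MapsTo φ (wiredForest G u) (wiredForest G' u') :=
  fun x y => and_congr (h.forest hu x y)
    (by rw [(h.below hu _).infAt, (h.below hu _).infAt, hu])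

theorem measurable_forest {Ω : Type*} [MeasurableSpace Ω] [Countable V]
    {u : Ω → Sym2 V → unitInterval} (hu : ∀ e, Measurable fun ω => u ω e) (x y : V) :
    Measurable fun ω => (forest G (u ω)).Adj x y :=
  measurable_const.and (measurable_reachable
    (measurable_below (fun _ _ => measurable_const) hu (hu _)) x y).not

theorem measurable_wiredForest {Ω : Type*} [MeasurableSpace Ω] [Countable V]
    {u : Ω → Sym2 V → unitInterval} (hu : ∀ e, Measurable fun ω => u ω e) (x y : V) :
    Measurable fun ω => (wiredForest G (u ω)).Adj x y :=
  have hb := measurable_below (H := fun _ : Ω => G) (fun _ _ => measurable_const) hu (hu s(x, y))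
  (measurable_forest hu x y).and ((measurable_infAt hb x).and (measurable_infAt hb y)).not

theorem mapsTo_aut (φ : G ≃g G) : MapsTo φ.toEquiv G G := fun _ _ => φ.map_adj_iff.symm

theorem label_shift (φ : V ≃ V) (ω : Config V) (x y : V) :
    label (shift φ ω) s(x, y) = label ω s(φ x, φ y) := rfl

theorem label'_shift (φ : V ≃ V) (ω : Config V) (x y : V) :
    label' (shift φ ω) s(x, y) = label' ω s(φ x, φ y) := rfl

theorem isRandomSubgraph_forest [Countable V] :
    IsRandomSubgraph G fun ω => forest G (label ω) :=
  ⟨fun _ => forest_le, measurable_forest fun e => by fun_prop,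
    fun φ ω => (mapsTo_aut φ).forest (label_shift _ ω)⟩

theorem isRandomSubgraph_wiredForest [Countable V] :
    IsRandomSubgraph G fun ω => wiredForest G (label ω) :=
  ⟨fun _ => wiredForest_le.trans forest_le, measurable_wiredForest fun e => by fun_prop,
    fun φ ω => (mapsTo_aut φ).wiredForest (label_shift _ ω)⟩

theorem isRandomSubgraph_below_forest [Countable V] (r : unitInterval) :
    IsRandomSubgraph G fun ω => below (forest G (label ω)) (label' ω) r :=
  ⟨fun _ => below_le.trans forest_le, measurable_below (measurable_forest fun e => by fun_prop)
    (fun e => by fun_prop) measurable_const,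
    fun φ ω => ((mapsTo_aut φ).forest (label_shift _ ω)).below (label'_shift _ ω) r⟩

/-- All components of the wired forest are infinite, as the edge of smallest label leaving a finite
set of vertices belongs to the wired forest. -/
theorem infAt_wiredForest [G.LocallyFinite] [Infinite V] (hconn : G.Connected) (x : V) :
    InfAt (wiredForest G u) x := by
  by_contra hfin
  have hS := Set.not_infinite.1 hfin
  set S := {z | (wiredForest G u).Reachable x z} with hSdef
  have hbd : {p : V × V | p.1 ∈ S ∧ p.2 ∉ S ∧ G.Adj p.1 p.2}.Finite := by
    refine (hS.biUnion (t := fun a => (fun b => (a, b)) '' G.neighborSet a)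
      fun a _ => (Set.toFinite _).image _).subset ?_
    rintro ⟨a, b⟩ ⟨ha, -, hab⟩
    exact Set.mem_biUnion ha ⟨b, hab, rfl⟩
  obtain ⟨y, hy⟩ := hS.exists_notMem
  obtain ⟨a, b, ha, hb, hab, -⟩ := exists_adj_leaving (S := (· ∈ S)) (SimpleGraph.Reachable.refl x)
    hy (hconn.preconnected x y)
  obtain ⟨⟨a, b⟩, ⟨ha, hb, hab⟩, hmin⟩ := Set.exists_min_image _ (fun p => u s(p.1, p.2)) hbd
    ⟨(a, b), ha, hb, hab⟩
  have hstay : ∀ z, (below G u (u s(a, b))).Reachable a z → z ∈ S := by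
    intro z hz
    by_contra hzS
    obtain ⟨c, d, hc, hd, hcd, -⟩ := exists_adj_leaving (S := (· ∈ S)) ha hzS hz
    exact absurd hcd.2 (not_lt.2 (hmin (c, d) ⟨hc, hd, hcd.1⟩))
  have hadj : (wiredForest G u).Adj a b :=
    ⟨⟨hab, fun h => hb (hstay b h)⟩, fun h => h.1 (hS.subset hstay)⟩
  exact hb (SimpleGraph.Reachable.trans ha hadj.reachable)

/-- When the labels are distinct, the forest has no cycle: its edge of largest label would not
belong to the forest. -/
theorem forest_isBridge (hinj : Function.Injective u) (hab : (forest G u).Adj a b) :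
    ¬ ((forest G u).deleteEdges {s(a, b)}).Reachable a b := by
  classical
  intro hr
  obtain ⟨z, c, hc, he⟩ :=
    SimpleGraph.adj_and_reachable_delete_edges_iff_exists_cycle.1 ⟨hab, hr⟩
  obtain ⟨e, hec, hmax⟩ := Finset.exists_max_image c.edges.toFinset u ⟨_, List.mem_toFinset.2 he⟩
  simp only [List.mem_toFinset] at hec hmax
  induction e with
  | _ p q =>
  let K : SimpleGraph V := SimpleGraph.mk (fun x y => (forest G u).Adj x y ∧ u s(x, y) ≤ u s(p, q))
    ⟨fun x y h => ⟨h.1.symm, by rw [Sym2.eq_swap]; exact h.2⟩⟩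
    ⟨fun x h => (forest G u).loopless.irrefl x h.1⟩
  have hK : ∀ e ∈ c.edges, e ∈ K.edgeSet := by
    intro e he
    have h1 := c.edges_subset_edgeSet he
    have h2 := hmax e he
    induction e with
    | _ x y => exact ⟨h1, h2⟩
  obtain ⟨hpq, hpqr⟩ := SimpleGraph.adj_and_reachable_delete_edges_iff_exists_cycle.2
    ⟨z, c.transfer K hK, hc.transfer hK, by simpa using hec⟩
  refine hpq.1.2 (hpqr.mono fun x y hxy => ?_)
  obtain ⟨h1, h2⟩ := deleteEdge_adj.1 hxy
  exact ⟨h1.1.1, lt_of_le_of_ne h1.2 fun h => h2 (hinj h)⟩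

end Forests

/-! ### Percolation on forests with at most two ends -/

section TwoEnds

variable {V : Type*} {F : SimpleGraph V} {a b c d : V}

/-- In a forest, the part of the graph beyond `b → c` is contained in the part beyond `a → b`. -/
theorem reachable_beyond (hF : ∀ a b, F.Adj a b → ¬ (F.deleteEdges {s(a, b)}).Reachable a b)
    (hbc : F.Adj b c) (hca : c ≠ a) {z : V}
    (hz : (F.deleteEdges {s(b, c)}).Reachable c z) :
    (F.deleteEdges {s(a, b)}).Reachable b z := by
  have hadj : (F.deleteEdges {s(a, b)}).Adj b c := by
    refine deleteEdge_adj.2 ⟨hbc, fun h => ?_⟩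
    rcases Sym2.eq_iff.1 h with ⟨h1, h2⟩ | ⟨-, h2⟩
    · exact hbc.ne h2.symm
    · exact hca h2
  refine hadj.reachable.trans (reachable_of_closed (H := F.deleteEdges {s(b, c)})
    (S := fun w => (F.deleteEdges {s(b, c)}).Reachable c w) (.refl _) ?_ hz).2
  intro w w' hw hww'
  have hw' := hw.trans hww'.reachable
  refine ⟨hw', SimpleGraph.Adj.reachable (deleteEdge_adj.2 ⟨(deleteEdge_adj.1 hww').1, fun h => ?_⟩)⟩
  rcases Sym2.eq_iff.1 h with ⟨-, rfl⟩ | ⟨rfl, -⟩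
  · exact hF _ _ hbc hw'.symm
  · exact hF _ _ hbc hw.symm

variable (hfin : ∀ x, (F.neighborSet x).Finite)

/-- A chosen continuation of a directed edge that points to infinity. -/
noncomputable def continuation (p : {p : V × V // ToInf F p.1 p.2}) :
    {p : V × V // ToInf F p.1 p.2} :=
  ⟨(p.1.2, (p.2.exists_next (hfin p.1.2)).choose), (p.2.exists_next (hfin p.1.2)).choose_spec.2⟩

theorem continuation_fst (p : {p : V × V // ToInf F p.1 p.2}) :
    (continuation hfin p).1.1 = p.1.2 := rfl

theorem continuation_snd_ne (p : {p : V × V // ToInf F p.1 p.2}) :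
    (continuation hfin p).1.2 ≠ p.1.1 :=
  (p.2.exists_next (hfin p.1.2)).choose_spec.1

/-- The edges of the path to infinity obtained by iterating `continuation`. -/
noncomputable def rayEdge (p : {p : V × V // ToInf F p.1 p.2}) (n : ℕ) : Sym2 V :=
  s(((continuation hfin)^[n] p).1.1, ((continuation hfin)^[n] p).1.2)

theorem rayEdge_injective (hF : ∀ a b, F.Adj a b → ¬ (F.deleteEdges {s(a, b)}).Reachable a b)
    (p : {p : V × V // ToInf F p.1 p.2}) : Function.Injective (rayEdge hfin p) := by
  set q : ℕ → {p : V × V // ToInf F p.1 p.2} := fun n => (continuation hfin)^[n] p with hq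
  have hsucc : ∀ n, q (n + 1) = continuation hfin (q n) := fun n =>
    Function.iterate_succ_apply' _ _ _
  -- The part of the graph beyond the `n`-th edge decreases with `n`.
  let S : ℕ → Set V := fun n => {z | (F.deleteEdges {s((q n).1.1, (q n).1.2)}).Reachable (q n).1.2 z}
  have hS : Antitone S := antitone_nat_of_succ_le fun n z hz => by
    have h1 : (q (n + 1)).1.1 = (q n).1.2 := by rw [hsucc, continuation_fst]
    have h2 : (q (n + 1)).1.2 ≠ (q n).1.1 := by rw [hsucc]; exact continuation_snd_ne hfin _
    have hz' : (F.deleteEdges {s((q (n + 1)).1.1, (q (n + 1)).1.2)}).Reachable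
      (q (n + 1)).1.2 z := hz
    have hadj := (q (n + 1)).2.1
    rw [h1] at hz' hadj
    exact reachable_beyond hF hadj h2 hz'
  have hfst : ∀ n, (q n).1.1 ∉ S n := fun n h => hF _ _ (q n).2.1 h.symm
  have hlt : ∀ n m, n < m → rayEdge hfin p n ≠ rayEdge hfin p m := by
    intro n m hnm heq
    have h2 : (q m).1.2 ∈ S n := hS hnm.le (SimpleGraph.Reachable.refl _)
    have h1 : (q m).1.1 ∈ S n := by
      obtain ⟨m, rfl⟩ := Nat.exists_eq_succ_of_ne_zero (Nat.ne_zero_of_lt hnm)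
      have : (q (m + 1)).1.1 = (q m).1.2 := by rw [hsucc, continuation_fst]
      rw [Nat.succ_eq_add_one, this]
      exact hS (Nat.lt_succ_iff.1 hnm) (SimpleGraph.Reachable.refl _)
    have heq' : s((q n).1.1, (q n).1.2) = s((q m).1.1, (q m).1.2) := heq
    rcases Sym2.eq_iff.1 heq' with ⟨h, -⟩ | ⟨h, -⟩
    · exact hfst n (h ▸ h1)
    · exact hfst n (h ▸ h2)
  intro n m h
  rcases lt_trichotomy n m with h' | h' | h'
  · exact absurd h (hlt _ _ h')
  · exact h'
  · exact absurd h.symm (hlt _ _ h')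

/-- Fix pairwise different edges. Almost surely not all of them have label less than `r < 1`. -/
theorem ae_exists_label_ge {ι : Type*} {e : ℕ → ι} (he : Function.Injective e) {r : unitInterval}
    (hr : r < 1) : ∀ᵐ u ∂unif ι, ∃ n, r ≤ u (e n) := by
  classical
  rw [ae_iff]
  simp only [not_exists, not_le]
  have hvol : (volume (Set.Iio r) : ENNReal) < 1 := by
    rw [unitInterval.volume_Iio]
    exact ENNReal.ofReal_lt_one.2 hr
  have hbound : ∀ N : ℕ, unif ι {u | ∀ n, u (e n) < r} ≤ volume (Set.Iio r) ^ N := by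
    intro N
    have h1 : {u : ι → unitInterval | ∀ n, u (e n) < r} ⊆
        Set.pi (((Finset.range N).map ⟨e, he⟩ : Finset ι) : Set ι) fun _ => Set.Iio r := by
      intro u hu i hi
      simp only [Finset.coe_map, Function.Embedding.coeFn_mk, Set.mem_image] at hi
      obtain ⟨n, -, rfl⟩ := hi
      exact hu n
    refine (measure_mono h1).trans ?_
    rw [Measure.infinitePi_pi _ fun i _ => measurableSet_Iio]
    simp
  have hlim := ENNReal.tendsto_pow_atTop_nhds_zero_of_lt_one hvol
  exact le_antisymm (ge_of_tendsto' hlim hbound) bot_le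

theorem ToInf.mono {H : SimpleGraph V} (hle : H ≤ F) (h : ToInf H a b) : ToInf F a b :=
  ⟨hle h.1, h.2.mono fun _ _ hxy => by
    obtain ⟨h1, h2⟩ := deleteEdge_adj.1 hxy
    exact deleteEdge_adj.2 ⟨hle h1, h2⟩⟩

/-- If the outward weight of `b` is two and `b → c` points to infinity but `c → b` does not, then
`b → c` is the only edge at `b` that points to infinity. -/
theorem eq_of_not_toInf (h2 : ∑' y, outWeight F b y = 2) (hbc : ToInf F b c)
    (hcb : ¬ ToInf F c b) (hbd : ToInf F b d) : d = c := by
  by_contra hne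
  have h := add_le_tsum (outWeight F b) (Ne.symm hne)
  rw [h2, outWeight, if_pos hbc, if_neg hcb] at h
  have h' := (add_le_add_right (one_le_outWeight hbd) 2).trans h
  norm_num at h'

/-- If the outward weight of `b` is two, then at most two edges at `b` point to infinity. -/
theorem eq_of_toInf (h2 : ∑' y, outWeight F b y = 2) (hba : ToInf F b a) (hbc : ToInf F b c)
    (hca : c ≠ a) (hbd : ToInf F b d) (hda : d ≠ a) : d = c := by
  classical
  by_contra hne
  have h := ENNReal.sum_le_tsum (f := outWeight F b) {a, c, d}
  rw [h2, Finset.sum_insert (by simp [hca.symm, hda.symm]), Finset.sum_pair (Ne.symm hne)] at h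
  have h' := (add_le_add (one_le_outWeight hba)
    (add_le_add (one_le_outWeight hbc) (one_le_outWeight hbd))).trans h
  norm_num at h'

/-- Let every vertex have outward weight two. An infinite component of a subgraph then contains one
of the paths to infinity made of continuations: its edges that point to infinity have only one
continuation, once one of them points to infinity in both directions, or if none of them does. -/
theorem exists_ray_of_infAt (h2 : ∀ x, ∑' y, outWeight F x y = 2) {K : SimpleGraph V} (hle : K ≤ F)
    {x : V} (hx : InfAt K x) : ∃ p, ∀ n, rayEdge hfin p n ∈ K.edgeSet := by
  have hfinK : ∀ x, (K.neighborSet x).Finite := fun x => (hfin x).subset fun _ h => hle h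
  -- `P p` is a property of directed edges inherited by the continuation.
  have main : ∀ P : V → V → Prop, (∀ a b, P a b → ToInf K a b) →
      (∀ a b c d, P a b → c ≠ a → ToInf K b c → d ≠ a → ToInf F b d → d = c ∧ P b c) →
      (∃ a b, P a b) → ∃ p, ∀ n, rayEdge hfin p n ∈ K.edgeSet := by
    rintro P hP hstep ⟨a, b, hab⟩
    let p : {p : V × V // ToInf F p.1 p.2} := ⟨(a, b), (hP a b hab).mono hle⟩
    have hall : ∀ n, P ((continuation hfin)^[n] p).1.1 ((continuation hfin)^[n] p).1.2 := by
      intro n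
      induction n with
      | zero => exact hab
      | succ n ih =>
        rw [Function.iterate_succ_apply']
        set q := (continuation hfin)^[n] p
        obtain ⟨c, hca, hc⟩ := (hP _ _ ih).exists_next (hfinK _)
        obtain ⟨h1, h3⟩ := hstep _ _ c (continuation hfin q).1.2 ih hca hc
          (continuation_snd_ne hfin q) (continuation hfin q).2
        rw [h1]
        exact h3
    exact ⟨p, fun n => (hP _ _ (hall n)).1⟩
  by_cases hneut : ∃ a b, ToInf K a b ∧ ToInf F b a
  · refine main (fun a b => ToInf K a b ∧ ToInf F b a) (fun _ _ h => h.1) ?_ hneut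
    rintro a b c d ⟨hab, hba⟩ hca hbc hda hbd
    refine ⟨eq_of_toInf (h2 b) hba (hbc.mono hle) hca hbd hda, hbc, ?_⟩
    by_contra hcb
    exact hca (eq_of_not_toInf (h2 b) (hbc.mono hle) hcb hba).symm
  · push Not at hneut
    obtain ⟨y, hy⟩ := exists_toInf (hfinK x) hx
    refine main (ToInf K) (fun _ _ h => h) ?_ ⟨x, y, hy⟩
    intro a b c d hab hca hbc hda hbd
    exact ⟨eq_of_not_toInf (h2 b) (hbc.mono hle) (hneut _ _ hbc) hbd, hbc⟩

/-- Bernoulli percolation with parameter less than one on a forest all of whose vertices have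
outward weight two has no infinite cluster. -/
theorem ae_not_infAt_below [Countable V]
    (hF : ∀ a b, F.Adj a b → ¬ (F.deleteEdges {s(a, b)}).Reachable a b)
    (hfin : ∀ x, (F.neighborSet x).Finite)
    (h2 : ∀ x, ∑' y, outWeight F x y = 2) {r : unitInterval} (hr : r < 1) :
    ∀ᵐ u ∂unif (Sym2 V), ∀ x, ¬ InfAt (below F u r) x := by
  have h : ∀ᵐ u ∂unif (Sym2 V), ∀ p, ∃ n, r ≤ u (rayEdge hfin p n) :=
    ae_all_iff.2 fun p => ae_exists_label_ge (rayEdge_injective hfin hF p) hr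
  filter_upwards [h] with u hu x hx
  obtain ⟨p, hp⟩ := exists_ray_of_infAt hfin h2 below_le hx
  obtain ⟨n, hn⟩ := hu p
  exact absurd (hp n).2 (not_lt.2 hn)

end TwoEnds

/-! ### Finite energy -/

section FiniteEnergy

variable {V : Type*} {G : SimpleGraph V} {u : Sym2 V → unitInterval}
  {p q s t : unitInterval} {x y z a b : V}

theorem label_update [DecidableEq V] (ω : Config V) (e : Sym2 V) (t : unitInterval) :
    label (Function.update ω (.inl e) t) = Function.update (label ω) e t := by
  ext f
  by_cases h : f = e
  · subst h; simp [label]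
  · simp [label, h]

theorem measurable_below_label [Countable V] (p : unitInterval) (x y : V) :
    Measurable fun ω : Config V => (below G (label ω) p).Adj x y :=
  measurable_below (fun _ _ => measurable_const) (fun e => by fun_prop) measurable_const x y

theorem le_label_of_not_reachable (hxy : G.Adj x y) (hn : ¬ (below G u p).Reachable x y) :
    p ≤ u s(x, y) := by
  by_contra h
  exact hn (SimpleGraph.Adj.reachable (G := below G u p) ⟨hxy, not_le.1 h⟩)

/-- At level `p`, the cluster of `x` is infinite, and different from the cluster of `z`, which
contains an infinite cluster of level `q`. -/
def Separated (G : SimpleGraph V) (u : Sym2 V → unitInterval) (q p : unitInterval) (x z : V) :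
    Prop :=
  InfAt (below G u p) x ∧ (∃ w, (below G u p).Reachable z w ∧ InfAt (below G u q) w) ∧
    ¬ (below G u p).Reachable x z

theorem below_le_below_update [DecidableEq V] {e : Sym2 V} (he : s ≤ u e) (t : unitInterval) :
    below G u s ≤ below G (Function.update u e t) s := by
  intro a b hab
  refine ⟨hab.1, ?_⟩
  have : s(a, b) ≠ e := by
    rintro rfl
    exact absurd hab.2 (not_lt.2 he)
  rw [Function.update_of_ne this]
  exact hab.2

theorem below_update_eq [DecidableEq V] {e : Sym2 V} (he : s ≤ u e) (ht : s ≤ t) :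
    below G (Function.update u e t) s = below G u s := by
  refine le_antisymm ?_ (below_le_below_update he t)
  rintro c d ⟨hcd, hlt⟩
  refine ⟨hcd, ?_⟩
  by_cases hce : s(c, d) = e
  · rw [hce, Function.update_self] at hlt
    exact absurd hlt (not_lt.2 ht)
  · rwa [Function.update_of_ne hce] at hlt

theorem below_update_self_le [DecidableEq V] {e : Sym2 V} :
    below G (Function.update u e t) t ≤ below G u t := by
  rintro c d ⟨hcd, hlt⟩
  refine ⟨hcd, ?_⟩
  by_cases hce : s(c, d) = e
  · rw [hce, Function.update_self] at hlt
    exact absurd hlt (lt_irrefl _)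
  · rwa [Function.update_of_ne hce] at hlt

/-- Opening the first edge of a path that joins two separated vertices moves the first of them one
step along the path, unless the clusters of its endpoints were separated. -/
theorem Separated.update [DecidableEq V] (hqp : q ≤ p) (h : Separated G u q p x z)
    (hxy : G.Adj x y) (hn : ¬ (below G u p).Reachable x y)
    (hy : ¬ ∃ w, (below G u p).Reachable y w ∧ InfAt (below G u q) w) (ht : t < p) :
    Separated G (Function.update u s(x, y) t) q p y z := by
  obtain ⟨hx, ⟨w, hw, hw'⟩, hxz⟩ := h
  have hle := le_label_of_not_reachable hxy hn
  have hp := below_le_below_update (G := G) hle t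
  have hq := below_le_below_update (G := G) (hqp.trans hle) t
  have hadj : (below G (Function.update u s(x, y) t) p).Adj x y := ⟨hxy, by simpa using ht⟩
  have hyz : ¬ (below G u p).Reachable z y := fun h => hy ⟨w, h.symm.trans hw, hw'⟩
  refine ⟨(hx.mono hp).of_reachable hadj.reachable, ⟨w, hw.mono hp, hw'.mono hq⟩, fun hr => ?_⟩
  refine hyz (reachable_of_closed (H' := below G (Function.update u s(x, y) t) p)
    (S := fun v => (below G u p).Reachable z v) (.refl z) ?_ hr.symm).1
  intro c d hc hcd
  refine ⟨?_, hcd.reachable⟩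
  have hne : s(c, d) ≠ s(x, y) := by
    intro he
    rcases Sym2.eq_iff.1 he with ⟨rfl, -⟩ | ⟨rfl, -⟩
    · exact hxz hc.symm
    · exact hyz hc
  refine hc.trans (SimpleGraph.Adj.reachable ⟨hcd.1, ?_⟩)
  have := hcd.2
  rwa [Function.update_of_ne hne] at this

/-- If two separated vertices exist with positive probability, so do adjacent ones. -/
theorem exists_adj_separated [Countable V] (hconn : G.Connected) (hqp : q ≤ p) (hp : 0 < p)
    (h : unif (Index V) {ω | Separated G (label ω) q p x z} ≠ 0) :
    ∃ a b, G.Adj a b ∧ unif (Index V) {ω | Separated G (label ω) q p a b} ≠ 0 := by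
  classical
  by_contra! hcon
  refine h ?_
  obtain ⟨w⟩ := hconn.preconnected x z
  clear h
  induction w with
  | nil =>
    convert measure_empty (μ := unif (Index V))
    ext ω
    simp [Separated]
  | @cons x y z hxy w ih =>
    by_contra hne
    have hA : unif (Index V) {ω | Separated G (label ω) q p x z ∧
        ¬ (below G (label ω) p).Reachable x y ∧
        ¬ ∃ w, (below G (label ω) p).Reachable y w ∧ InfAt (below G (label ω) q) w} ≠ 0 := by
      intro h0
      refine hne (measure_mono_null ?_ (measure_union_null h0
        (measure_union_null (hcon x y hxy) ih)))
      intro ω hω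
      obtain ⟨h1, h2, h3⟩ := id hω
      by_cases hr : (below G (label ω) p).Reachable x y
      · exact .inr (.inr ⟨h1.of_reachable hr, h2, fun h => h3 (hr.trans h)⟩)
      · by_cases hy : ∃ w, (below G (label ω) p).Reachable y w ∧ InfAt (below G (label ω) q) w
        · exact .inr (.inl ⟨h1, hy, hr⟩)
        · exact .inl ⟨hω, hr, hy⟩
    refine unif_ne_zero_of_update (.inl s(x, y)) (T := Set.Iio p) ?_ hA ?_ ih
    · rw [unitInterval.volume_Iio]
      exact (ENNReal.ofReal_pos.2 hp).ne'
    · rintro ω ⟨hω, hr, hy⟩ t ht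
      change Separated G (label (Function.update ω _ t)) q p y z
      rw [label_update]
      exact hω.update hqp hxy hr hy ht

end FiniteEnergy

/-! ### Monotonicity of uniqueness -/

section Monotonicity

variable {V : Type*} {K K' : SimpleGraph V} {I I' : V → Prop} {a b a' b' v : V}

/-- The side of `a` of the edge `ab`. -/
def side (K : SimpleGraph V) (a b : V) : Set V := {v | (K.deleteEdges {s(a, b)}).Reachable a v}

/-- The edge `ab` is the only link of an infinite set of vertices, on the side of `a`, that avoids
the set `I`, with the set `I`, which is met by the component of `b`. -/
def IsLink (K : SimpleGraph V) (I : V → Prop) (a b : V) : Prop :=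
  K.Adj a b ∧ InfAt (K.deleteEdges {s(a, b)}) a ∧ (∀ v ∈ side K a b, ¬ I v) ∧
    ∃ w, (K.deleteEdges {s(a, b)}).Reachable b w ∧ I w

theorem IsLink.notMem_side (h : IsLink K I a b) : b ∉ side K a b := by
  obtain ⟨-, -, h1, w, hw, hI⟩ := h
  exact fun hb => h1 w (SimpleGraph.Reachable.trans hb hw) hI

theorem eq_of_leaves_side {c d : V} (hc : c ∈ side K a b) (hd : d ∉ side K a b)
    (hcd : K.Adj c d) : c = a ∧ d = b := by
  by_cases he : s(c, d) = s(a, b)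
  · rcases Sym2.eq_iff.1 he with h | ⟨-, rfl⟩
    · exact h
    · exact absurd (SimpleGraph.Reachable.refl _) hd
  · have hadj : (K.deleteEdges {s(a, b)}).Adj c d := deleteEdge_adj.2 ⟨hcd, he⟩
    exact absurd (SimpleGraph.Reachable.trans hc hadj.reachable) hd

theorem mem_side_of_not_subset (hv : v ∈ side K a b) (hv' : v ∈ side K a' b')
    (h : ¬ side K a' b' ⊆ side K a b) : a ∈ side K a' b' ∧ b ∈ side K a' b' := by
  obtain ⟨z, hz, hzn⟩ := Set.not_subset.1 h
  have hr : (K.deleteEdges {s(a', b')}).Reachable v z :=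
    SimpleGraph.Reachable.trans (SimpleGraph.Reachable.symm hv') hz
  obtain ⟨c, d, hc, hd, hcd, hvc⟩ := exists_adj_leaving (S := (· ∈ side K a b)) hv hzn hr
  obtain ⟨rfl, rfl⟩ := eq_of_leaves_side hc hd (deleteEdge_le hcd)
  have hc' : c ∈ side K a' b' := SimpleGraph.Reachable.trans hv' hvc
  exact ⟨hc', SimpleGraph.Reachable.trans hc' hcd.reachable⟩

/-- The infinite sides of two links are disjoint or nested. -/
theorem IsLink.nested (h : IsLink K I a b) (h' : IsLink K I a' b') (hv : v ∈ side K a b)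
    (hv' : v ∈ side K a' b') : side K a b ⊆ side K a' b' ∨ side K a' b' ⊆ side K a b := by
  by_contra! hcon
  obtain ⟨-, hb⟩ := mem_side_of_not_subset hv hv' hcon.2
  obtain ⟨ha', -⟩ := mem_side_of_not_subset hv' hv hcon.1
  obtain ⟨w, hw, hI⟩ := h.2.2.2
  obtain ⟨c, d, hc, hd, hcd, hbc⟩ := exists_adj_leaving (S := (· ∈ side K a' b')) hb
    (fun hw' => h'.2.2.1 w hw' hI) hw
  obtain ⟨rfl, rfl⟩ := eq_of_leaves_side hc hd (deleteEdge_le hcd)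
  exact h.notMem_side (SimpleGraph.Reachable.trans ha' hbc.symm)

/-- The vertex `v` sends mass to `a` if `a` is the endpoint of the link whose infinite side is the
largest one containing `v`. -/
def Sends (K : SimpleGraph V) (I : V → Prop) (v a : V) : Prop :=
  ∃ b, IsLink K I a b ∧ v ∈ side K a b ∧
    ∀ a' b', IsLink K I a' b' → v ∈ side K a' b' → ∀ z, z ∈ side K a' b' → z ∈ side K a b

theorem Sends.unique (h : Sends K I v a) (h' : Sends K I v a') : a = a' := by
  obtain ⟨b, hb, hv, hmax⟩ := h
  obtain ⟨b', hb', hv', hmax'⟩ := h'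
  exact (eq_of_leaves_side (hmax' a b hb hv a (SimpleGraph.Reachable.refl _))
    (fun h => hb.notMem_side (hmax a' b' hb' hv' b h)) hb.1).1

/-- If there is a link, then some vertex receives mass from infinitely many vertices. -/
theorem IsLink.exists_infinite_sends (h : IsLink K I a b) :
    ∃ a', {v | Sends K I v a'}.Infinite := by
  classical
  let Z : Set (V × V) := {p | IsLink K I p.1 p.2 ∧ a ∈ side K p.1 p.2}
  obtain ⟨w, hw, hI⟩ := h.2.2.2
  obtain ⟨W⟩ : K.Reachable a w := h.1.reachable.trans (hw.mono deleteEdge_le)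
  -- A path from `a` to `I` crosses all links that have `a` on their infinite side.
  have hZ : Z.Finite := by
    refine ((List.finite_toSet W.support).prod (List.finite_toSet W.support)).subset ?_
    rintro ⟨c, d⟩ ⟨hl, hs⟩
    have he : s(c, d) ∈ W.edges := by
      by_contra he
      exact hl.2.2.1 w (SimpleGraph.Reachable.trans hs ⟨W.toDeleteEdge _ he⟩) hI
    exact ⟨W.fst_mem_support_of_mem_edges he, W.snd_mem_support_of_mem_edges he⟩
  obtain ⟨⟨c, d⟩, ⟨hl, hs⟩, hmax⟩ := hZ.exists_maximalFor (fun p => side K p.1 p.2) Z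
    ⟨(a, b), h, SimpleGraph.Reachable.refl _⟩
  refine ⟨c, Set.Infinite.mono (fun v hv => ⟨d, hl, hv, fun a' b' hl' hv' => ?_⟩) hl.2.1⟩
  rcases hl'.nested hl hv' hv with h1 | h1
  · exact h1
  · exact hmax (j := (a', b')) ⟨hl', h1 hs⟩ h1

theorem MapsTo.mem_side {φ : V ≃ V} (h : MapsTo φ K K') :
    v ∈ side K a b ↔ φ v ∈ side K' (φ a) (φ b) :=
  h.deleteEdge.reachable

theorem MapsTo.isLink {φ : V ≃ V} (h : MapsTo φ K K') (hI : ∀ x, I x ↔ I' (φ x)) :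
    IsLink K I a b ↔ IsLink K' I' (φ a) (φ b) := by
  simp only [IsLink, h a b, h.deleteEdge.infAt, h.mem_side, h.deleteEdge.reachable, hI]
  rw [φ.forall_congr_left (p := fun v => φ v ∈ side K' (φ a) (φ b) → ¬ I' (φ v)),
    φ.exists_congr_left (p := fun w =>
      (K'.deleteEdges {s(φ a, φ b)}).Reachable (φ b) (φ w) ∧ I' (φ w))]
  simp

theorem MapsTo.sends {φ : V ≃ V} (h : MapsTo φ K K') (hI : ∀ x, I x ↔ I' (φ x)) :
    Sends K I v a ↔ Sends K' I' (φ v) (φ a) := by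
  constructor
  · rintro ⟨b, hb, hv, hmax⟩
    refine ⟨φ b, (h.isLink hI).1 hb, h.mem_side.1 hv, fun a' b' hl hv' z hz => ?_⟩
    obtain ⟨a', rfl⟩ := φ.surjective a'
    obtain ⟨b', rfl⟩ := φ.surjective b'
    obtain ⟨z, rfl⟩ := φ.surjective z
    exact h.mem_side.1 (hmax a' b' ((h.isLink hI).2 hl) (h.mem_side.2 hv') z (h.mem_side.2 hz))
  · rintro ⟨b, hb, hv, hmax⟩
    obtain ⟨b, rfl⟩ := φ.surjective b
    exact ⟨b, (h.isLink hI).2 hb, h.mem_side.2 hv, fun a' b' hl hv' z hz =>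
      h.mem_side.2 (hmax _ _ ((h.isLink hI).1 hl) (h.mem_side.1 hv') _ (h.mem_side.1 hz))⟩

section Measurability

variable {Ω : Type*} [MeasurableSpace Ω] [Countable V] {K : Ω → SimpleGraph V} {I : Ω → V → Prop}

theorem measurable_mem_side (hK : ∀ x y, Measurable fun ω => (K ω).Adj x y) (a b v : V) :
    Measurable fun ω => v ∈ side (K ω) a b :=
  measurable_reachable (measurable_deleteEdge hK _) a v

theorem measurable_isLink (hK : ∀ x y, Measurable fun ω => (K ω).Adj x y)
    (hI : ∀ x, Measurable fun ω => I ω x) (a b : V) : Measurable fun ω => IsLink (K ω) (I ω) a b :=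
  (hK a b).and ((measurable_infAt (measurable_deleteEdge hK _) a).and
    ((Measurable.forall fun v => (measurable_mem_side hK a b v).imp (hI v).not).and
      (Measurable.exists fun w =>
        (measurable_reachable (measurable_deleteEdge hK _) b w).and (hI w))))

theorem measurable_sends (hK : ∀ x y, Measurable fun ω => (K ω).Adj x y)
    (hI : ∀ x, Measurable fun ω => I ω x) (v a : V) : Measurable fun ω => Sends (K ω) (I ω) v a :=
  Measurable.exists fun b => (measurable_isLink hK hI a b).and
    ((measurable_mem_side hK a b v).and (Measurable.forall fun a' => Measurable.forall fun b' =>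
      (measurable_isLink hK hI a' b').imp ((measurable_mem_side hK a' b' v).imp
        (Measurable.forall fun z =>
          (measurable_mem_side hK a' b' z).imp (measurable_mem_side hK a b z)))))

end Measurability

variable {G : SimpleGraph V} {q p : unitInterval}

/-- There are no links between the clusters of level `p` and the infinite clusters of level `q`:
a vertex sends mass at most one, so it cannot receive infinite mass. -/
theorem ae_not_isLink [G.LocallyFinite] (hconn : G.Connected) (hunim : IsUnimodular G)
    (htrans : IsTransitive G) (q p : unitInterval) : ∀ᵐ ω ∂unif (Index V), ∀ a b,
    ¬ IsLink (below G (label ω) p) (InfAt (below G (label ω) q)) a b := by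
  have := countable_of_connected hconn
  let F : Config V → V → V → ENNReal := fun ω v a =>
    ind (Sends (below G (label ω) p) (InfAt (below G (label ω) q)) v a)
  have hm : ∀ v a, Measurable fun ω => F ω v a := fun v a =>
    measurable_ind (measurable_sends (measurable_below_label p)
      (fun x => measurable_infAt (measurable_below_label q) x) v a)
  have hF : ∀ (φ : G ≃g G) ω v a, F (shift φ.toEquiv ω) v a = F ω (φ v) (φ a) := by
    intro φ ω v a
    exact ind_congr (MapsTo.sends ((mapsTo_aut φ).below (label_shift _ ω) p)
      fun x => ((mapsTo_aut φ).below (label_shift _ ω) q).infAt)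
  have hfin : ∀ᵐ ω ∂unif (Index V), ∀ a, ∑' v, F ω v a < ⊤ := by
    rw [ae_all_iff]
    intro a
    refine ae_lt_top (Measurable.tsum fun v => hm v a) (ne_of_lt ?_)
    rw [← lintegral_mass_transport hconn hunim htrans hm hF a]
    calc ∫⁻ ω, ∑' y, F ω a y ∂unif (Index V) ≤ ∫⁻ _, 1 ∂unif (Index V) :=
          lintegral_mono fun ω => tsum_ind_le_one fun _ _ h h' => h.unique h'
      _ < ⊤ := by simp
  filter_upwards [hfin] with ω hω a b hab
  obtain ⟨a', ha'⟩ := hab.exists_infinite_sends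
  refine ha' ((ENNReal.finite_const_le_of_tsum_ne_top (hω a').ne one_ne_zero).subset fun v hv => ?_)
  exact (ind_true hv).ge

/-- Uniqueness of the infinite cluster is inherited by higher levels. A second infinite cluster
could be joined to a cluster containing the infinite cluster of the lower level by opening a single
edge, which would then be a link. -/
theorem ae_reachable_of_lt [G.LocallyFinite] (hconn : G.Connected) (hunim : IsUnimodular G)
    (htrans : IsTransitive G) (hqp : q < p)
    (hex : ∀ᵐ ω ∂unif (Index V), ∃ x, InfAt (below G (label ω) q) x)
    (huniq : ∀ᵐ ω ∂unif (Index V), ∀ x y, InfAt (below G (label ω) q) x →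
      InfAt (below G (label ω) q) y → (below G (label ω) q).Reachable x y) :
    ∀ᵐ ω ∂unif (Index V), ∀ x y, InfAt (below G (label ω) p) x →
      InfAt (below G (label ω) p) y → (below G (label ω) p).Reachable x y := by
  classical
  have := countable_of_connected hconn
  have hnull : ∀ x z, unif (Index V) {ω | Separated G (label ω) q p x z} = 0 := by
    intro x z
    by_contra hne
    obtain ⟨a, b, hab, hpos⟩ := exists_adj_separated hconn hqp.le (bot_le.trans_lt hqp) hne
    have hA : unif (Index V) ({ω | Separated G (label ω) q p a b} ∩ {ω | ∀ x y,
        InfAt (below G (label ω) q) x → InfAt (below G (label ω) q) y →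
        (below G (label ω) q).Reachable x y}) ≠ 0 := by
      refine fun h0 => hpos (measure_mono_null ?_ (measure_union_null h0 (ae_iff.1 huniq)))
      intro ω hω
      by_cases hu : ∀ x y, InfAt (below G (label ω) q) x → InfAt (below G (label ω) q) y →
          (below G (label ω) q).Reachable x y
      · exact .inl ⟨hω, hu⟩
      · exact .inr hu
    refine unif_ne_zero_of_update (.inl s(a, b)) (T := Set.Ico q p)
      (B := {ω | IsLink (below G (label ω) p) (InfAt (below G (label ω) q)) a b}) ?_ hA ?_ ?_
    · rw [unitInterval.volume_Ico]
      exact (ENNReal.ofReal_pos.2 (sub_pos.2 hqp)).ne'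
    · rintro ω ⟨⟨h1, ⟨w, hw, hw'⟩, h3⟩, hu⟩ t ht
      change IsLink (below G (label (Function.update ω _ t)) p)
        (InfAt (below G (label (Function.update ω _ t)) q)) a b
      rw [label_update]
      have hle := le_label_of_not_reachable hab h3
      have hD : (below G (Function.update (label ω) s(a, b) t) p).deleteEdges {s(a, b)} =
          below G (label ω) p := by
        ext c d
        rw [deleteEdge_adj]
        constructor
        · rintro ⟨⟨hcd, hlt⟩, hne⟩
          rw [Function.update_of_ne hne] at hlt
          exact ⟨hcd, hlt⟩
        · rintro hcd
          exact ⟨below_le_below_update hle t hcd, fun he => absurd hcd.2 (by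
            rw [he]; exact not_lt.2 hle)⟩
      have hQ : below G (Function.update (label ω) s(a, b) t) q = below G (label ω) q :=
        below_update_eq (hqp.le.trans hle) ht.1
      refine ⟨⟨hab, by simpa using ht.2⟩, ?_, ?_, w, ?_, ?_⟩
      · rw [hD]; exact h1
      · intro v hv
        rw [side, Set.mem_ofPred_eq, hD] at hv
        rw [hQ]
        intro hv'
        exact h3 (hv.trans (((hu v w hv' hw').mono (below_mono le_rfl hqp.le)).trans hw.symm))
      · rw [hD]; exact hw
      · rw [hQ]; exact hw'
    · refine measure_mono_null ?_ (ae_iff.1 (ae_not_isLink hconn hunim htrans q p))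
      intro ω hω h
      exact h a b hω
  have hall : ∀ᵐ ω ∂unif (Index V), ∀ x z, ¬ Separated G (label ω) q p x z := by
    simp only [ae_all_iff]
    intro x z
    rw [ae_iff]
    simpa using hnull x z
  filter_upwards [hall, hex] with ω hω ⟨w, hw⟩ x y hx hy
  have hreach : ∀ x, InfAt (below G (label ω) p) x → (below G (label ω) p).Reachable x w := by
    intro x hx
    by_contra hn
    exact hω x w ⟨hx, ⟨w, .refl w, hw⟩, hn⟩
  exact (hreach x hx).trans (hreach y hy).symm

end Monotonicity

/-! ### Critical probabilities in terms of labels on all pairs of vertices -/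

section Transfer

variable {V : Type*} {G H K : SimpleGraph V} {p r : unitInterval}

theorem infinite_supp_iff {x : V} : (K.connectedComponentMk x).supp.Infinite ↔ InfAt K x := by
  have h : (K.connectedComponentMk x).supp = {z | K.Reachable x z} := by
    ext z
    simp [SimpleGraph.reachable_comm]
  rw [h, InfAt]

theorem exists_infinite_component_iff :
    (∃ C : K.ConnectedComponent, C.supp.Infinite) ↔ ∃ x, InfAt K x := by
  constructor
  · rintro ⟨C, hC⟩
    obtain ⟨x, rfl⟩ := C.exists_rep
    exact ⟨x, infinite_supp_iff.1 hC⟩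
  · rintro ⟨x, hx⟩
    exact ⟨K.connectedComponentMk x, infinite_supp_iff.2 hx⟩

theorem existsUnique_infinite_component_iff :
    (∃! C : K.ConnectedComponent, C.supp.Infinite) ↔
      (∃ x, InfAt K x) ∧ ∀ x y, InfAt K x → InfAt K y → K.Reachable x y := by
  constructor
  · intro hu
    refine ⟨exists_infinite_component_iff.1 hu.exists, fun x y hx hy => ?_⟩
    exact SimpleGraph.ConnectedComponent.exact
      (hu.unique (infinite_supp_iff.2 hx) (infinite_supp_iff.2 hy))
  · rintro ⟨⟨x, hx⟩, hu⟩
    refine ⟨K.connectedComponentMk x, infinite_supp_iff.2 hx, fun C hC => ?_⟩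
    obtain ⟨y, rfl⟩ := C.exists_rep
    exact SimpleGraph.ConnectedComponent.sound (hu y x (infinite_supp_iff.1 hC) hx)

theorem percolation_eq_below (u : Sym2 V → unitInterval) (p : unitInterval) :
    percolation H (fun e => u e) p = below H u p := by
  ext x y
  exact ⟨fun ⟨h, h'⟩ => ⟨h, h'⟩, fun ⟨h, h'⟩ => ⟨h, h'⟩⟩

open Classical in
/-- Extend edge labels to all unordered pairs of vertices. -/
noncomputable def extend (H : SimpleGraph V) (U : H.edgeSet → unitInterval) (e : Sym2 V) :
    unitInterval :=
  if h : e ∈ H.edgeSet then U ⟨e, h⟩ else 0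

theorem restrict_extend (U : H.edgeSet → unitInterval) :
    (fun e : H.edgeSet => extend H U e) = U := by
  ext e
  simp [extend]

theorem measurable_extend : Measurable (extend H) := by
  classical
  refine measurable_pi_lambda _ fun e => ?_
  by_cases h : e ∈ H.edgeSet
  · simp only [extend, h, dite_true]; fun_prop
  · simp only [extend, h, dite_false]; fun_prop

/-- A property of the labels of the edges of `H` holds almost surely for labels on these edges if
and only if it does for labels on all pairs of vertices. -/
theorem ae_labelLaw_iff {P : (H.edgeSet → unitInterval) → Prop}
    (hP : MeasurableSet {u : Sym2 V → unitInterval | P fun e => u e}) :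
    (∀ᵐ U ∂labelLaw H, P U) ↔ ∀ᵐ u ∂unif (Sym2 V), P fun e => u e := by
  have hmp : MeasurePreserving (fun (u : Sym2 V → unitInterval) (e : H.edgeSet) => u e)
    (unif (Sym2 V)) (labelLaw H) := measurePreserving_unif_comp Subtype.val_injective
  have hm : MeasurableSet {U | P U} := by
    have : {U | P U} = extend H ⁻¹' {u : Sym2 V → unitInterval | P fun e => u e} := by
      ext U
      simp only [Set.mem_preimage, Set.mem_ofPred_eq, restrict_extend]
    rw [this]
    exact measurable_extend hP
  rw [← hmp.map_eq, ae_map_iff hmp.measurable.aemeasurable hm]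

theorem measurePreserving_label :
    MeasurePreserving (label : Config V → Sym2 V → unitInterval) (unif (Index V))
      (unif (Sym2 V)) := measurePreserving_unif_comp Sum.inl_injective

theorem ae_label_iff {P : (Sym2 V → unitInterval) → Prop} (hP : MeasurableSet {u | P u}) :
    (∀ᵐ u ∂unif (Sym2 V), P u) ↔ ∀ᵐ ω ∂unif (Index V), P (label ω) := by
  rw [← measurePreserving_label.map_eq,
    ae_map_iff measurePreserving_label.measurable.aemeasurable hP]

theorem measurable_below_id (p : unitInterval) (x y : V) :
    Measurable fun u : Sym2 V → unitInterval => (below H u p).Adj x y :=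
  measurable_below (fun _ _ => measurable_const) (fun e => by fun_prop) measurable_const x y

theorem measurable_exists_infAt [Countable V] (p : unitInterval) :
    Measurable fun u : Sym2 V → unitInterval => ∃ x, InfAt (below H u p) x :=
  Measurable.exists fun x => measurable_infAt (measurable_below_id p) x

theorem ae_exists_infinite_iff [Countable V] :
    (∀ᵐ U ∂labelLaw H, ∃ C : (percolation H U p).ConnectedComponent, C.supp.Infinite) ↔
      ∀ᵐ u ∂unif (Sym2 V), ∃ x, InfAt (below H u p) x := by
  simp only [exists_infinite_component_iff]
  rw [ae_labelLaw_iff]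
  · simp only [percolation_eq_below]
  · simp only [percolation_eq_below]
    exact measurableSet_setOfPred.2 (measurable_exists_infAt p)

theorem measurable_unique [Countable V] (p : unitInterval) :
    Measurable fun u : Sym2 V → unitInterval => (∃ x, InfAt (below H u p) x) ∧
      ∀ x y, InfAt (below H u p) x → InfAt (below H u p) y → (below H u p).Reachable x y :=
  have hm := measurable_below_id (H := H) p
  (measurable_exists_infAt p).and (Measurable.forall fun x => Measurable.forall fun y =>
    (measurable_infAt hm x).imp ((measurable_infAt hm y).imp (measurable_reachable hm x y)))

theorem ae_existsUnique_infinite_iff [Countable V] :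
    (∀ᵐ U ∂labelLaw H, ∃! C : (percolation H U p).ConnectedComponent, C.supp.Infinite) ↔
      ∀ᵐ u ∂unif (Sym2 V), (∃ x, InfAt (below H u p) x) ∧
        ∀ x y, InfAt (below H u p) x → InfAt (below H u p) y → (below H u p).Reachable x y := by
  simp only [existsUnique_infinite_component_iff]
  rw [ae_labelLaw_iff]
  · simp only [percolation_eq_below]
  · simp only [percolation_eq_below]
    exact measurableSet_setOfPred.2 (measurable_unique p)

theorem ae_exists_infAt_of_lt [Countable V] (h : criticalProb G < p) :
    ∀ᵐ ω ∂unif (Index V), ∃ x, InfAt (below G (label ω) p) x := by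
  obtain ⟨q, hq, hqp⟩ := sInf_lt_iff.1 h
  have h1 := (ae_label_iff (measurableSet_setOfPred.2 (measurable_exists_infAt q))).1
    (ae_exists_infinite_iff.1 hq)
  filter_upwards [h1] with ω ⟨x, hx⟩
  exact ⟨x, hx.mono (below_mono le_rfl hqp.le)⟩

theorem not_ae_exists_infAt_of_lt [Countable V] (h : p < criticalProb G) :
    ¬ ∀ᵐ ω ∂unif (Index V), ∃ x, InfAt (below G (label ω) p) x := fun hae =>
  not_le.2 h (sInf_le (ae_exists_infinite_iff.2
    ((ae_label_iff (measurableSet_setOfPred.2 (measurable_exists_infAt p))).2 hae)))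

theorem not_ae_unique_of_lt [Countable V] (h : p < uniquenessProb G) :
    ¬ ∀ᵐ ω ∂unif (Index V), (∃ x, InfAt (below G (label ω) p) x) ∧
        ∀ x y, InfAt (below G (label ω) p) x → InfAt (below G (label ω) p) y →
          (below G (label ω) p).Reachable x y := fun hae =>
  not_le.2 h (sInf_le (ae_existsUnique_infinite_iff.2
    ((ae_label_iff (measurableSet_setOfPred.2 (measurable_unique p))).2 hae)))

theorem exists_ae_unique_of_lt [Countable V] (h : uniquenessProb G < p) :
    ∃ q < p, ∀ᵐ ω ∂unif (Index V), (∃ x, InfAt (below G (label ω) q) x) ∧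
        ∀ x y, InfAt (below G (label ω) q) x → InfAt (below G (label ω) q) y →
          (below G (label ω) q).Reachable x y := by
  obtain ⟨q, hq, hqp⟩ := sInf_lt_iff.1 h
  exact ⟨q, hqp, (ae_label_iff (measurableSet_setOfPred.2 (measurable_unique q))).1
    (ae_existsUnique_infinite_iff.1 hq)⟩

theorem criticalProb_eq_one_of_ae [Countable V]
    (h : ∀ r < 1, ∀ᵐ u ∂unif (Sym2 V), ∀ x, ¬ InfAt (below H u r) x) : criticalProb H = 1 := by
  refine le_antisymm unitInterval.le_one' (le_sInf fun r hr => ?_)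
  by_contra hr1
  obtain ⟨u, ⟨x, hx⟩, hu⟩ := ((ae_exists_infinite_iff.1 hr).and (h r (not_le.1 hr1))).exists
  exact hu x hx

theorem criticalProb_eq_one_of_finite [Finite V] : criticalProb H = 1 :=
  criticalProb_eq_one_of_ae fun _ _ => .of_forall fun _ _ h => h (Set.toFinite _)

end Transfer

/-! ### The difference between the free and the wired forest -/

section Comparison

variable {V : Type*} {G : SimpleGraph V} {u : Sym2 V → unitInterval} {a b : V}
  {t : unitInterval}

/-- At level `t`, the clusters of `a` and `b` are infinite and different. -/
def InfSeparated (G : SimpleGraph V) (u : Sym2 V → unitInterval) (t : unitInterval) (a b : V) :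
    Prop :=
  InfAt (below G u t) a ∧ InfAt (below G u t) b ∧ ¬ (below G u t).Reachable a b

theorem measurable_infSeparated [Countable V] {t : Config V → unitInterval} (ht : Measurable t)
    (a b : V) : Measurable fun ω : Config V => InfSeparated G (label ω) (t ω) a b :=
  have hb := measurable_below (H := fun _ : Config V => G) (fun _ _ => measurable_const)
    (fun e => measurable_label e) ht
  (measurable_infAt hb a).and ((measurable_infAt hb b).and (measurable_reachable hb a b).not)

/-- Conditioning on the label of `ab`. -/
theorem unif_infSeparated_eq_zero_iff [Countable V] [DecidableEq V] :
    unif (Index V) {ω | InfSeparated G (label ω) (label ω s(a, b)) a b} = 0 ↔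
      ∀ᵐ t, unif (Index V)
        {ω | InfSeparated G (Function.update (label ω) s(a, b) t) t a b} = 0 := by
  rw [unif_eq_zero_iff_update (.inl s(a, b)) (measurableSet_setOfPred.2
    (measurable_infSeparated (measurable_label _) a b))]
  have (ω : Config V) (t : unitInterval) :
      Function.update ω (.inl s(a, b)) t ∈
        {ω | InfSeparated G (label ω) (label ω s(a, b)) a b} ↔
      InfSeparated G (Function.update (label ω) s(a, b) t) t a b := by
    rw [Set.mem_ofPred_eq, label_update, Function.update_self]
  simp only [this]

/-- Between the critical probability and the uniqueness threshold there are adjacent vertices in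
different infinite clusters, so some edge is in the free but not in the wired forest. -/
theorem exists_infSeparated [G.LocallyFinite] (hconn : G.Connected)
    (h : criticalProb G < uniquenessProb G) :
    ∃ a b, G.Adj a b ∧
      unif (Index V) {ω | InfSeparated G (label ω) (label ω s(a, b)) a b} ≠ 0 := by
  classical
  have := countable_of_connected hconn
  by_contra! hcon
  have hae : ∀ᵐ t : unitInterval, ∀ a b, G.Adj a b → unif (Index V)
      {ω | InfSeparated G (Function.update (label ω) s(a, b) t) t a b} = 0 := by
    simp only [ae_all_iff]
    exact fun a b hab => unif_infSeparated_eq_zero_iff.1 (hcon a b hab)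
  have hvol : volume (Set.Ioo (criticalProb G) (uniquenessProb G)) ≠ 0 := by
    rw [unitInterval.volume_Ioo]
    exact (ENNReal.ofReal_pos.2 (sub_pos.2 h)).ne'
  obtain ⟨t, ht, ht'⟩ : ∃ t ∈ Set.Ioo (criticalProb G) (uniquenessProb G), ∀ a b, G.Adj a b →
      unif (Index V) {ω | InfSeparated G (Function.update (label ω) s(a, b) t) t a b} = 0 := by
    by_contra! hno
    refine hvol (measure_mono_null ?_ (ae_iff.1 hae))
    intro t ht hall
    obtain ⟨a, b, hab, hne⟩ := hno t ht
    exact hne (hall a b hab)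
  have hsep : ∃ x z, unif (Index V) {ω | Separated G (label ω) t t x z} ≠ 0 := by
    by_contra! hz
    refine not_ae_unique_of_lt ht.2 ?_
    have hz' : ∀ᵐ ω ∂unif (Index V), ∀ x z, ¬ Separated G (label ω) t t x z := by
      simp only [ae_all_iff]
      intro x z
      rw [ae_iff]
      simpa using hz x z
    filter_upwards [hz', ae_exists_infAt_of_lt ht.1] with ω hω hex
    refine ⟨hex, fun x y hx hy => ?_⟩
    by_contra hn
    exact hω x y ⟨hx, ⟨y, .refl y, hy⟩, hn⟩
  obtain ⟨x, z, hxz⟩ := hsep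
  obtain ⟨a, b, hab, hne⟩ := exists_adj_separated hconn le_rfl (bot_le.trans_lt ht.1) hxz
  refine hne (measure_mono_null ?_ (ht' a b hab))
  rintro ω ⟨h1, ⟨w, hw, hw'⟩, h3⟩
  have hle := le_label_of_not_reachable hab h3
  rw [Set.mem_ofPred_eq, InfSeparated, below_update_eq hle le_rfl]
  exact ⟨h1, hw'.of_reachable hw.symm, h3⟩

/-- If the critical probability equals the uniqueness threshold, then the edges of the free forest
almost surely belong to the wired forest. -/
theorem unif_infSeparated_eq_zero [G.LocallyFinite] [Infinite V] (hconn : G.Connected)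
    (hunim : IsUnimodular G) (htrans : IsTransitive G) (h : uniquenessProb G ≤ criticalProb G)
    (a b : V) :
    unif (Index V) {ω | InfSeparated G (label ω) (label ω s(a, b)) a b} = 0 := by
  classical
  have := countable_of_connected hconn
  rw [unif_infSeparated_eq_zero_iff]
  have hne : ∀ c : unitInterval, ∀ᵐ t : unitInterval, t ≠ c := fun c => by
    rw [ae_iff]; simp
  filter_upwards [hne (uniquenessProb G), hne 1] with t htu ht1
  rcases lt_or_gt_of_ne htu with hlt | hgt
  · -- Below the critical probability there is no infinite cluster.
    rcases zero_or_one_of_shift hconn htrans (A := {ω | ∃ x, InfAt (below G (label ω) t) x})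
      (measurableSet_setOfPred.2 (Measurable.exists fun x =>
        measurable_infAt (measurable_below_label t) x)) (fun φ ω => by
          refine (φ.toEquiv.exists_congr_left).trans (exists_congr fun x => ?_)
          have := ((mapsTo_aut φ).below (label_shift _ ω) t).infAt (x := φ.toEquiv.symm x)
          rwa [Equiv.apply_symm_apply] at this) with h0 | h1
    · refine measure_mono_null ?_ h0
      rintro ω ⟨hω, -⟩
      exact ⟨a, hω.mono below_update_self_le⟩
    · refine absurd ?_ (not_ae_exists_infAt_of_lt (hlt.trans_le h))
      rw [ae_iff_measure_eq (measurableSet_setOfPred.2 (Measurable.exists fun x =>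
        measurable_infAt (measurable_below_label t) x)).nullMeasurableSet, h1, measure_univ]
  · -- Above the uniqueness threshold there is only one infinite cluster.
    obtain ⟨q, hqt, hq⟩ := exists_ae_unique_of_lt hgt
    have huniq := ae_reachable_of_lt hconn hunim htrans hqt (hq.mono fun _ h => h.1)
      (hq.mono fun _ h => h.2)
    by_contra hpos
    refine unif_ne_zero_of_update (.inl s(a, b)) (T := Set.Ici t)
      (B := {ω | InfSeparated G (label ω) t a b}) ?_ hpos ?_ ?_
    · rw [unitInterval.volume_Ici]
      have ht1' : t < 1 := lt_of_le_of_ne unitInterval.le_one' ht1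
      exact (ENNReal.ofReal_pos.2 (sub_pos.2 ht1')).ne'
    · intro ω hω s hs
      rw [Set.mem_ofPred_eq, label_update]
      have heq : below G (Function.update (label ω) s(a, b) s) t =
          below G (Function.update (label ω) s(a, b) t) t := by
        rw [← Function.update_idem (f := label ω) (a := s(a, b)) t s]
        exact below_update_eq (by simp) hs
      rw [InfSeparated, heq]
      exact hω
    · refine measure_mono_null ?_ (ae_iff.1 huniq)
      rintro ω ⟨h1, h2, h3⟩ hall
      exact h3 (hall a b h1 h2)

end Comparison

/-! ### Percolation on the free forest -/

section FreeForest

variable {V : Type*} {G : SimpleGraph V}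

theorem infAt_forest [G.LocallyFinite] [Infinite V] (hconn : G.Connected)
    (u : Sym2 V → unitInterval) (x : V) : InfAt (forest G u) x :=
  (infAt_wiredForest hconn x).mono wiredForest_le

/-- If the uniqueness threshold is the critical probability, then the free forest has critical
probability one: it equals the wired forest, whose expected degree is two. -/
theorem ae_criticalProb_eq_one [G.LocallyFinite] [Infinite V] (hconn : G.Connected)
    (hunim : IsUnimodular G) (htrans : IsTransitive G) (h : uniquenessProb G ≤ criticalProb G) :
    ∀ᵐ ω ∂unif (Index V), criticalProb (forest G (label ω)) = 1 := by
  have := countable_of_connected hconn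
  have hinf : ∀ᵐ ω ∂unif (Index V), ∀ x, InfAt (forest G (label ω)) x :=
    .of_forall fun ω => infAt_forest hconn _
  have hnot : ∀ᵐ ω ∂unif (Index V), ∀ a b,
      ¬ InfSeparated G (label ω) (label ω s(a, b)) a b := by
    simp only [ae_all_iff]
    intro a b
    rw [ae_iff]
    simpa using unif_infSeparated_eq_zero hconn hunim htrans h a b
  have hdeg : ∀ o, expDegree (fun ω => forest G (label ω)) o ≤ 2 := by
    refine expDegree_le_two hconn hunim htrans isRandomSubgraph_forest ?_
    filter_upwards [hnot] with ω hω x y hxy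
    have hle := below_mono (u := label ω) (forest_le (G := G) (u := label ω))
      (le_refl (label ω s(x, y)))
    refine ⟨fun hr => hxy.2 (hr.mono hle), ?_⟩
    by_contra! hboth
    exact hω x y ⟨hboth.1.mono hle, hboth.2.mono hle, hxy.2⟩
  have htwo := ae_tsum_outWeight_eq_two hconn hunim htrans isRandomSubgraph_forest hinf hdeg
  filter_upwards [htwo, ae_injective_unif (α := Index V)] with ω hω hinj
  exact criticalProb_eq_one_of_ae fun r hr => ae_not_infAt_below
    (fun a b => forest_isBridge (hinj.comp Sum.inl_injective))
    (fun x => neighborSet_finite forest_le x) hω hr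

/-- Independent thinning multiplies the expected degree by the retention probability. -/
theorem expDegree_below_forest [Countable V] (r : unitInterval) (o : V) :
    expDegree (fun ω => below (forest G (label ω)) (label' ω) r) o =
      expDegree (fun ω => forest G (label ω)) o * ENNReal.ofReal r := by
  classical
  rw [expDegree_eq_tsum (isRandomSubgraph_below_forest (G := G) r).meas,
    expDegree_eq_tsum (isRandomSubgraph_forest (G := G)).meas, ← ENNReal.tsum_mul_right]
  refine tsum_congr fun y => ?_
  rw [← unitInterval.volume_Iio, ← unif_inter_label (.inr s(o, y)) (measurableSet_setOfPred.2
    ((isRandomSubgraph_forest (G := G)).meas o y)) _ measurableSet_Iio]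
  · rfl
  · intro ω t
    have : label (Function.update ω (.inr s(o, y)) t) = label ω := by
      ext e; simp [label]
    simp only [Set.mem_ofPred_eq, this]

/-- If the critical probability is less than the uniqueness threshold, then the expected degree of
the free forest exceeds two, as it exceeds that of the wired forest. -/
theorem exists_two_lt_expDegree [G.LocallyFinite] [Infinite V] (hconn : G.Connected)
    (hunim : IsUnimodular G) (htrans : IsTransitive G) (h : criticalProb G < uniquenessProb G) :
    ∃ o, 2 < expDegree (fun ω => forest G (label ω)) o := by
  classical
  have := countable_of_connected hconn
  obtain ⟨a, b, hab, hpos⟩ := exists_infSeparated hconn h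
  refine ⟨a, ?_⟩
  set c := unif (Index V) {ω | InfSeparated G (label ω) (label ω s(a, b)) a b} with hc
  have hw : 2 ≤ expDegree (fun ω => wiredForest G (label ω)) a :=
    two_le_expDegree hconn hunim htrans isRandomSubgraph_wiredForest
      (.of_forall fun ω => infAt_wiredForest hconn) a
  have hsum : expDegree (fun ω => wiredForest G (label ω)) a + c ≤
      expDegree (fun ω => forest G (label ω)) a := by
    rw [expDegree_eq_tsum (isRandomSubgraph_wiredForest (G := G)).meas,
      expDegree_eq_tsum (isRandomSubgraph_forest (G := G)).meas,
      ← tsum_ite_eq b (fun _ => c), ← ENNReal.tsum_add]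
    refine ENNReal.tsum_le_tsum fun y => ?_
    split_ifs with hy
    · subst hy
      rw [hc, ← measure_union]
      · refine measure_mono ?_
        rintro ω (hω | hω)
        · exact hω.1
        · exact ⟨hab, hω.2.2⟩
      · rw [Set.disjoint_left]
        intro ω hω hω'
        exact hω.2 ⟨hω'.1, hω'.2.1⟩
      · exact measurableSet_setOfPred.2 (measurable_infSeparated (measurable_label _) _ _)
    · rw [add_zero]
      exact measure_mono fun ω hω => hω.1
  calc (2 : ENNReal) < 2 + c := ENNReal.lt_add_right (by norm_num) hpos
    _ ≤ _ := (add_le_add_left hw c).trans hsum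

/-- If the critical probability is less than the uniqueness threshold, then some percolation of
parameter `r < 1` on the free forest has an infinite cluster: otherwise its expected degree would
be at most two. -/
theorem exists_ae_infAt_below_forest [G.LocallyFinite] [Infinite V] (hconn : G.Connected)
    (hunim : IsUnimodular G) (htrans : IsTransitive G) (h : criticalProb G < uniquenessProb G) :
    ∃ r : unitInterval, r < 1 ∧ ∀ᵐ ω ∂unif (Index V),
      ∃ x, InfAt (below (forest G (label ω)) (label' ω) r) x := by
  have := countable_of_connected hconn
  obtain ⟨o, ho⟩ := exists_two_lt_expDegree hconn hunim htrans h
  obtain ⟨r, hr1, hr⟩ : ∃ r : unitInterval, r < 1 ∧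
      2 < expDegree (fun ω => forest G (label ω)) o * ENNReal.ofReal r := by
    have hlt : 2 / expDegree (fun ω => forest G (label ω)) o < 1 :=
      ENNReal.div_lt_of_lt_mul (by simpa using ho)
    obtain ⟨c, hc, hc1⟩ := exists_between hlt
    have hct : c ≠ ⊤ := (hc1.trans ENNReal.one_lt_top).ne
    have hc1' : c.toReal < 1 := by
      rw [← ENNReal.toReal_one]
      exact (ENNReal.toReal_lt_toReal hct ENNReal.one_ne_top).2 hc1
    refine ⟨⟨c.toReal, ENNReal.toReal_nonneg, hc1'.le⟩, hc1', ?_⟩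
    rw [ENNReal.ofReal_toReal hct, mul_comm]
    exact (ENNReal.div_lt_iff (.inl (pos_of_gt ho).ne') (.inr (by norm_num))).1 hc
  refine ⟨r, hr1, ?_⟩
  have hR := isRandomSubgraph_below_forest (G := G) r
  have hmeas : MeasurableSet {ω | ∃ x, InfAt (below (forest G (label ω)) (label' ω) r) x} :=
    measurableSet_setOfPred.2 (Measurable.exists fun x => measurable_infAt hR.meas x)
  rcases zero_or_one_of_shift hconn htrans hmeas (fun φ ω => by
      refine (φ.toEquiv.exists_congr_left).trans (exists_congr fun x => ?_)
      have := (hR.equiv φ ω).infAt (x := φ.toEquiv.symm x)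
      rwa [Equiv.apply_symm_apply] at this) with h0 | h1
  · exfalso
    rw [← expDegree_below_forest] at hr
    refine not_le.2 hr (expDegree_le_two hconn hunim htrans hR ?_ o)
    have h0' : ∀ᵐ ω ∂unif (Index V), ¬ ∃ x, InfAt (below (forest G (label ω)) (label' ω) r) x := by
      rw [ae_iff]
      simpa using h0
    filter_upwards [h0'] with ω hω x y hxy
    refine ⟨fun hr => hxy.1.2 (hr.mono (below_mono (below_le.trans forest_le) le_rfl)), .inl ?_⟩
    exact fun hx => hω ⟨x, hx.mono below_le⟩
  · rw [ae_iff_measure_eq hmeas.nullMeasurableSet, h1, measure_univ]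

theorem measurableSet_infAt_below_forest [Countable V] (r : unitInterval) :
    MeasurableSet {z : (Sym2 V → unitInterval) × (Sym2 V → unitInterval) |
      ∃ x, InfAt (below (forest G z.1) z.2 r) x} :=
  measurableSet_setOfPred.2 (Measurable.exists fun x => measurable_infAt (measurable_below
    (measurable_forest fun e => by fun_prop) (fun e => by fun_prop) measurable_const) x)

theorem ae_criticalProb_lt_one [G.LocallyFinite] [Infinite V] (hconn : G.Connected)
    (hunim : IsUnimodular G) (htrans : IsTransitive G) (h : criticalProb G < uniquenessProb G) :
    ∀ᵐ U ∂labelLaw G, criticalProb (freeForest G U) < 1 := by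
  have := countable_of_connected hconn
  obtain ⟨r, hr1, hr⟩ := exists_ae_infAt_below_forest hconn hunim htrans h
  have hmp : MeasurePreserving (fun ω : Config V => (label ω, label' ω)) (unif (Index V))
    ((unif (Sym2 V)).prod (unif (Sym2 V))) := measurePreserving_unif_sum
  have hmeas := measurableSet_infAt_below_forest (G := G) r
  have hprod : ∀ᵐ z ∂(unif (Sym2 V)).prod (unif (Sym2 V)),
      ∃ x, InfAt (below (forest G z.1) z.2 r) x := by
    rw [← hmp.map_eq, ae_map_iff hmp.measurable.aemeasurable hmeas]
    exact hr
  have hae : ∀ᵐ u ∂unif (Sym2 V), ∀ᵐ u' ∂unif (Sym2 V),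
      ∃ x, InfAt (below (freeForest G fun e => u e) u' r) x := by
    simpa only [freeForest_eq_forest] using Measure.ae_ae_of_ae_prod hprod
  have hm : MeasurableSet {u : Sym2 V → unitInterval | ∀ᵐ u' ∂unif (Sym2 V),
      ∃ x, InfAt (below (freeForest G fun e => u e) u' r) x} := by
    simp only [freeForest_eq_forest]
    exact measurable_measure_prodMk_left (ν := unif (Sym2 V)) hmeas.compl (measurableSet_singleton 0)
  filter_upwards [(ae_labelLaw_iff (P := fun U => ∀ᵐ u' ∂unif (Sym2 V),
    ∃ x, InfAt (below (freeForest G U) u' r) x) hm).2 hae] with U hU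
  exact lt_of_le_of_lt (sInf_le (ae_exists_infinite_iff.2 hU)) hr1

end FreeForest

end MinimalForest

theorem corollary3p21 {V : Type*} (G : SimpleGraph V) [G.LocallyFinite]
    (hconn : G.Connected) (htrans : MinimalForest.IsTransitive G)
    (hunim : MinimalForest.IsUnimodular G) :
    MinimalForest.criticalProb G < MinimalForest.uniquenessProb G ↔
      ∀ᵐ U ∂(MinimalForest.labelLaw G),
        MinimalForest.criticalProb (MinimalForest.freeForest G U) < 1 := by
  open MinimalForest in
  rcases finite_or_infinite V with hV | hV
  · -- On a finite graph there are no infinite clusters, and all critical probabilities are one.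
    simp only [criticalProb_eq_one_of_finite, lt_irrefl]
    refine ⟨fun h => absurd h (not_lt.2 unitInterval.le_one'), fun h => ?_⟩
    have : IsProbabilityMeasure (labelLaw G) := by unfold labelLaw; infer_instance
    exact h.exists.choose_spec.elim
  · have := countable_of_connected hconn
    refine ⟨ae_criticalProb_lt_one hconn hunim htrans, fun h => ?_⟩
    by_contra hle
    have hmp : MeasurePreserving (fun (ω : Config V) (e : G.edgeSet) => label ω e)
      (unif (Index V)) (labelLaw G) :=
      measurePreserving_unif_comp (Sum.inl_injective.comp Subtype.val_injective)
    rw [← hmp.map_eq] at h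
    have h' := ae_of_ae_map hmp.measurable.aemeasurable h
    obtain ⟨ω, h1, h2⟩ := (h'.and
      (ae_criticalProb_eq_one hconn hunim htrans (not_lt.1 hle))).exists
    rw [freeForest_eq_forest, h2] at h1
    exact lt_irrefl _ h1
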